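/- Let $k$ be an algebraically closed field, let $n\ge 1$, and let $Q$ be a quiver of type $\mathbb A_n$: its vertices are $1,\dots,n$, and for each $1\le s<n$ it has exactly one arrow $\alpha_s$ joining $s$ and $s+1$, of arbitrary direction ($\alpha_s=\,\to$ if it goes from $s$ to $s+1$, and $\alpha_s=\,\leftarrow$ if it goes from $s+1$ to $s$). Let $\mathrm{Rep}(Q)$ be the category of finite-dimensional representations of $Q$ over $k$, with the exact vertex-wise tensor product $(M\otimes N)_v=M_v\otimes_k N_v$, $(M\otimes N)_\alpha=M_\alpha\otimes_k N_\alpha$, and let $D^b(\mathrm{Rep}(Q))$ be its bounded derived category with the induced tensor product of complexes. In a $k$-linear category $\mathcal C$, a brick is an object $X$ with $\mathrm{Hom}(X,X)=k$, and a finite brick set is a finite set $\phi=\{X_1,\dots,X_r\}$ of bricks with $\mathrm{Hom}(X_a,X_b)=0$ for $a\ne b$. For an endofunctor $\sigma$ of $\mathcal C$ let $$\mathrm{fpd}(\sigma)=\sup_{\phi}\,\rho\bigl((\dim_k\mathrm{Hom}(X_a,\sigma(X_b)))_{a,b}\bigr),$$ where $\phi$ runs over the finite brick sets of $\mathcal C$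 and $\rho$ is the spectral radius. For an object $X$ of $D^b(\mathrm{Rep}(Q))$ put $\mathrm{fpd}(X)=\mathrm{fpd}(X\otimes-)$, where $X\otimes-$ is regarded as an endofunctor of $D^b(\mathrm{Rep}(Q))$. For $1\le i\le j\le n$ let $M\{i,j\}$ be the representation that is $k$ at the vertices $s$ with $i\le s\le j$ and $0$ at the others, with $M\{i,j\}_{\alpha_s}=\mathrm{Id}_k$ for $i\le s<j$ and $0$ otherwise. Call $M\{i,j\}$ a sink if ($i=1$ or $\alpha_{i-1}=\,\to$) and ($j=n$ or $\alpha_j=\,\leftarrow$); a source if ($i=1$ or $\alpha_{i-1}=\,\leftarrow$) and ($j=n$ or $\alpha_j=\,\to$); a flow if $1<i$, $j<n$ and $\alpha_{i-1}=\alpha_j$. Then: 1. $\mathrm{fpd}(M\{i,j\}[m])=0$ for all integers $m<0$ and all $m>1$. 2. $\mathrm{fpd}(M\{i,j\}[0])$ equals $1$ if $M\{i,j\}$ is a sink, $\min\{i,n-j+1\}$ if it is a source, and $1$ if it is a flow. 3. $\mathrm{fpd}(M\{i,j\}[1])$ equals $\min\{i-1,n-j\}$ if $M\{i,j\}$ is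 a sink, $0$ if it is a source, and $0$ if it is a flow. -/

import Mathlib

open CategoryTheory MonoidalCategory Limits
open scoped ENNReal

universe w v u

/-! ## Quivers of type A and their finite dimensional representations -/

/-- The possible orientations of an edge. -/
inductive ArrowDir
  | right
  | left

/-- The vertices `1, …, n` of the quiver of type `Aₙ` with orientation `α`. -/
structure TypeAVertex (n : ℕ) (α : ℕ → ArrowDir) : Type where
  val : ℕ
  one_le : 1 ≤ val
  le : val ≤ n

/-- The quiver of type `Aₙ` with orientation `α`. For `1 ≤ s < n` it has exactly one arrow `α_s`
joining `s` and `s + 1`: it goes `s ⟶ s + 1` if `α s = right` and `s + 1 ⟶ s` if `α s = left`.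
Values of `α` outside `1, …, n - 1` are irrelevant. -/
instance TypeAVertex.quiver (n : ℕ) (α : ℕ → ArrowDir) : Quiver.{0} (TypeAVertex n α) where
  Hom a b := {s : ℕ // (α s = ArrowDir.right ∧ a.val = s ∧ b.val = s + 1) ∨
    (α s = ArrowDir.left ∧ a.val = s + 1 ∧ b.val = s)}

/-- The category of representations of the quiver `V` (with finitely many vertices) by finite
dimensional `k`-vector spaces. It is abelian and `k`-linear; its monoidal structure (the one of a
functor category) is the vertex-wise tensor product. -/
abbrev FinRep (k : Type u) [Field k] (V : Type) [Quiver.{0} V] := Paths V ⥤ FGModuleCat.{u} k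

/-- The interval module `M{i,j}`: it is `k` at the vertices `s` with `i ≤ s ≤ j` (written as the
functions on the one-point type `PLift (i ≤ s ∧ s ≤ j)`) and `0` at the others, and an arrow acts
as the identity of `k` if both its ends lie in `[i, j]`, and as zero otherwise. -/
def intervalModule (k : Type u) [Field k] (n : ℕ) (α : ℕ → ArrowDir) (i j : ℕ) :
    FinRep k (TypeAVertex n α) :=
  Paths.lift
    { obj := fun v => FGModuleCat.of k (PLift (i ≤ v.val ∧ v.val ≤ j) → k)
      map := fun {a _} _ => FGModuleCat.ofHom
        { toFun := fun x _ => if h : i ≤ a.val ∧ a.val ≤ j then x ⟨h⟩ else 0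
          map_add' := by intro x y; ext; dsimp; split_ifs <;> simp
          map_smul' := by intro x y; ext; dsimp; split_ifs <;> simp } }

/-- `M{i,j}` is a sink: `α_{i-1}` is `⟶` (or `i = 1`) and `α_j` is `⟵` (or `j = n`). -/
def IsSinkInterval (n : ℕ) (α : ℕ → ArrowDir) (i j : ℕ) : Prop :=
  (i = 1 ∨ α (i - 1) = ArrowDir.right) ∧ (j = n ∨ α j = ArrowDir.left)

/-- `M{i,j}` is a source: `α_{i-1}` is `⟵` (or `i = 1`) and `α_j` is `⟶` (or `j = n`). -/
def IsSourceInterval (n : ℕ) (α : ℕ → ArrowDir) (i j : ℕ) : Prop :=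
  (i = 1 ∨ α (i - 1) = ArrowDir.left) ∧ (j = n ∨ α j = ArrowDir.right)

/-- `M{i,j}` is a flow: both arrows `α_{i-1}` and `α_j` exist and have the same direction. -/
def IsFlowInterval (n : ℕ) (α : ℕ → ArrowDir) (i j : ℕ) : Prop :=
  1 < i ∧ j < n ∧ α (i - 1) = α j

namespace FinRep

instance {J : Type*} [Category* J] {D : Type*} [Category* D] [Preadditive D] [MonoidalCategory D]
    [MonoidalPreadditive D] : MonoidalPreadditive (J ⥤ D) where
  whiskerLeft_zero := NatTrans.ext (funext fun _ => MonoidalPreadditive.whiskerLeft_zero)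
  zero_whiskerRight := NatTrans.ext (funext fun _ => MonoidalPreadditive.zero_whiskerRight)
  whiskerLeft_add _ _ := NatTrans.ext (funext fun _ => MonoidalPreadditive.whiskerLeft_add _ _)
  add_whiskerRight _ _ := NatTrans.ext (funext fun _ => MonoidalPreadditive.add_whiskerRight _ _)

variable {k : Type u} [Field k] {V : Type} [Quiver.{0} V]

instance (X : FGModuleCat.{u} k) : PreservesFiniteLimits (tensorLeft X) where
  preservesFiniteLimits _ _ _ :=
    (tensorLeftAdjunction X
      (FGModuleCat.FGModuleCatDual k X)).rightAdjoint_preservesLimits.preservesLimitsOfShape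

instance (M : FinRep k V) : PreservesFiniteLimits (tensorLeft M) where
  preservesFiniteLimits J _ _ := preservesLimitsOfShape_of_evaluation _ _ fun v =>
    inferInstanceAs (PreservesLimitsOfShape J
      ((evaluation (Paths V) (FGModuleCat.{u} k)).obj v ⋙ tensorLeft (M.obj v)))

instance (M : FinRep k V) : PreservesFiniteColimits (tensorLeft M) where
  preservesFiniteColimits J _ _ := preservesColimitsOfShape_of_evaluation _ _ fun v =>
    inferInstanceAs (PreservesColimitsOfShape J
      ((evaluation (Paths V) (FGModuleCat.{u} k)).obj v ⋙ tensorLeft (M.obj v)))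

end FinRep

/-! ## The tensor product with a stalk complex on the bounded derived category -/

namespace StalkTensor

variable {C : Type u} [Category.{v} C] [Abelian C] [MonoidalCategory C] [MonoidalPreadditive C]

/-- The object `M`, regarded as a complex concentrated in degree `0`. -/
noncomputable abbrev single (M : C) : CochainComplex C ℤ :=
  (HomologicalComplex.single C (ComplexShape.up ℤ) 0).obj M

/-- The map from the summand `(single M).X p ⊗ L.X q` of the total tensor product to `M ⊗ L.X j`,
where `p + q = j`: the identification if `p = 0`, and zero otherwise. -/
noncomputable def summandMap (M : C) (L : CochainComplex C ℤ) (p q j : ℤ) (h : p + q = j) :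
    (single M).X p ⊗ L.X q ⟶ M ⊗ L.X j :=
  if hp : p = 0 then
    (HomologicalComplex.singleObjXIsoOfEq (ComplexShape.up ℤ) 0 M p hp).hom ⊗ₘ
      (L.XIsoOfEq (by omega)).hom
  else 0

set_option linter.unusedSectionVars false in
lemma summandMap_zero (M : C) (L : CochainComplex C ℤ) (q : ℤ) (h : 0 + q = q) :
    summandMap M L 0 q q h =
      (HomologicalComplex.singleObjXSelf (ComplexShape.up ℤ) 0 M).hom ▷ L.X q := by
  simp [summandMap, HomologicalComplex.singleObjXSelf]

lemma isZero_summand (M : C) (L : CochainComplex C ℤ) (p q : ℤ) (hp : p ≠ 0) :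
    IsZero ((single M).X p ⊗ L.X q) :=
  (tensorRight (L.X q)).map_isZero
    (HomologicalComplex.isZero_single_obj_X (ComplexShape.up ℤ) 0 M p hp)

/-- `M ⊗ L.X j` as a candidate for the coproduct of the `(single M).X p ⊗ L.X q`, `p + q = j`. -/
noncomputable def cofan (M : C) (L : CochainComplex C ℤ) (j : ℤ) :
    (((GradedObject.mapBifunctor (curriedTensor C) ℤ ℤ).obj (single M).X).obj L.X).CofanMapObjFun
      (ComplexShape.π (ComplexShape.up ℤ) (ComplexShape.up ℤ) (ComplexShape.up ℤ)) j :=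
  GradedObject.CofanMapObjFun.mk _ _ _ (M ⊗ L.X j) fun a ha => summandMap M L a.1 a.2 j ha

lemma summandMap_comp (M : C) (L : CochainComplex C ℤ) (q : ℤ) (h : 0 + q = q) {Z : C}
    (g : (single M).X 0 ⊗ L.X q ⟶ Z) : summandMap M L 0 q q h ≫
      (HomologicalComplex.singleObjXSelf (ComplexShape.up ℤ) 0 M).inv ▷ L.X q ≫ g = g := by
  rw [summandMap_zero, ← comp_whiskerRight_assoc]
  simp

lemma comp_summandMap (M : C) (L : CochainComplex C ℤ) (q : ℤ) (h : 0 + q = q) {Z : C}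
    (g : M ⊗ L.X q ⟶ Z) :
    (HomologicalComplex.singleObjXSelf (ComplexShape.up ℤ) 0 M).inv ▷ L.X q ≫
      summandMap M L 0 q q h ≫ g = g := by
  rw [summandMap_zero, ← comp_whiskerRight_assoc]
  simp

/-- `M ⊗ L.X j` is the coproduct of the `(single M).X p ⊗ L.X q` with `p + q = j`. -/
noncomputable def cofanIsColimit (M : C) (L : CochainComplex C ℤ) (j : ℤ) :
    IsColimit (cofan M L j) :=
  Cofan.IsColimit.mk _
    (fun s => ((HomologicalComplex.singleObjXSelf (ComplexShape.up ℤ) 0 M).inv ▷ L.X j) ≫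
      s.inj ⟨⟨0, j⟩, zero_add j⟩)
    (fun s => by
      rintro ⟨⟨p, q⟩, h⟩
      by_cases hp : p = 0
      · subst hp
        obtain rfl : q = j := by simpa using h
        exact summandMap_comp M L q h _
      · exact (isZero_summand M L p q hp).eq_of_src _ _)
    (fun s m hm => by
      rw [← hm ⟨⟨0, j⟩, zero_add j⟩]
      exact (comp_summandMap M L j (zero_add j) m).symm)

instance hasTensor (M : C) (L : CochainComplex C ℤ) : HomologicalComplex.HasTensor (single M) L :=
  GradedObject.CofanMapObjFun.hasMap _ _ _ (cofanIsColimit M L)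

/-- The identification of `M ⊗ L.X j` with the degree `j` term of the total tensor product. -/
noncomputable def compHom (M : C) (L : CochainComplex C ℤ) (j : ℤ) :
    M ⊗ L.X j ⟶ (HomologicalComplex.tensorObj (single M) L).X j :=
  ((HomologicalComplex.singleObjXSelf (ComplexShape.up ℤ) 0 M).inv ▷ L.X j) ≫
    HomologicalComplex.ιTensorObj (single M) L 0 j j (zero_add j)

/-- `compHom` as an isomorphism. -/
noncomputable def compIso (M : C) (L : CochainComplex C ℤ) (j : ℤ) :
    M ⊗ L.X j ≅ (HomologicalComplex.tensorObj (single M) L).X j where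
  hom := compHom M L j
  inv := HomologicalComplex.mapBifunctorDesc (fun p q h => summandMap M L p q j h)
  hom_inv_id := by
    simp [compHom, summandMap_zero, ← comp_whiskerRight]
  inv_hom_id := by
    apply HomologicalComplex.mapBifunctor.hom_ext
    intro p q h
    by_cases hp : p = 0
    · subst hp
      obtain rfl : q = j := by simpa using h
      simp [compHom, summandMap_zero, ← comp_whiskerRight_assoc]
    · exact (isZero_summand M L p q hp).eq_of_src _ _

lemma d₁_zero (M : C) (L : CochainComplex C ℤ) (i₁ i₂ j : ℤ) :
    HomologicalComplex.mapBifunctor.d₁ (single M) L (curriedTensor C) (ComplexShape.up ℤ) i₁ i₂ j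
      = 0 := by
  by_cases h₂ : i₁ + 1 + i₂ = j
  · rw [HomologicalComplex.mapBifunctor.d₁_eq (i₁' := i₁ + 1) _ _ _ _ (by simp) _ _ h₂,
      HomologicalComplex.single_obj_d, Functor.map_zero, zero_app, zero_comp, smul_zero]
  · rw [HomologicalComplex.mapBifunctor.d₁_eq_zero' (i₁' := i₁ + 1) _ _ _ _ (by simp) _ _ h₂]

lemma compHom_comm (M : C) (L : CochainComplex C ℤ) (i j : ℤ) (hij : i + 1 = j) :
    compHom M L i ≫ (HomologicalComplex.tensorObj (single M) L).d i j =
      (M ◁ L.d i j) ≫ compHom M L j := by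
  simp only [compHom, Category.assoc, HomologicalComplex.mapBifunctor.d_eq, Preadditive.comp_add,
      HomologicalComplex.mapBifunctor.ι_D₁, HomologicalComplex.mapBifunctor.ι_D₂, d₁_zero,
      comp_zero, zero_add]
  rw [HomologicalComplex.mapBifunctor.d₂_eq _ _ _ _ _ hij _ (by simp)]
  simp [whisker_exchange_assoc]

/-- The total tensor product of `M` (in degree `0`) with `L` is computed termwise. -/
noncomputable def tensorSingleIso (M : C) (L : CochainComplex C ℤ) :
    ((tensorLeft M).mapHomologicalComplex (ComplexShape.up ℤ)).obj L ≅
      HomologicalComplex.tensorObj (single M) L :=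
  HomologicalComplex.Hom.isoOfComponents (fun j => compIso M L j) (fun i j hij =>
    compHom_comm M L i j hij)


/-- The stalk complex `M[m]`. -/
noncomputable abbrev stalk (M : C) (m : ℤ) : CochainComplex C ℤ := (single M)⟦m⟧

/-- The functor `K ⊗ -` on cochain complexes, where `⊗` is the usual (total) tensor product of
complexes, `(K ⊗ L)ⁿ = ⨁_{p + q = n} Kᵖ ⊗ L^q` with `d = d_K ⊗ 1 + (-1)ᵖ 1 ⊗ d_L`. -/
noncomputable def tensorComplex (K : CochainComplex C ℤ)
    [∀ L : CochainComplex C ℤ, HomologicalComplex.HasTensor K L] :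
    CochainComplex C ℤ ⥤ CochainComplex C ℤ where
  obj L := HomologicalComplex.tensorObj K L
  map f := HomologicalComplex.tensorHom (𝟙 K) f
  map_id L := by
    ext j p q h
    simp
  map_comp f g := by
    ext j p q h
    simp

instance (M : C) (m : ℤ) (L : CochainComplex C ℤ) :
    HomologicalComplex.HasTensor (stalk M m) L :=
  inferInstanceAs (CochainComplex.HasMapBifunctor ((single M)⟦m⟧) L (curriedTensor C))

/-- `tensorSingleIso`, naturally in `L`. -/
noncomputable def tensorSingleNatIso (M : C) :
    tensorComplex (single M) ≅ (tensorLeft M).mapHomologicalComplex (ComplexShape.up ℤ) :=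
  (NatIso.ofComponents (fun L => tensorSingleIso M L) (by
    intro L L' f
    ext j
    change (M ◁ f.f j) ≫ compHom M L' j =
      compHom M L j ≫ (HomologicalComplex.tensorHom (𝟙 (single M)) f).f j
    simp [compHom, whisker_exchange_assoc])).symm

lemma shiftIso_naturality (M : C) (m : ℤ) {L L' : CochainComplex C ℤ} (f : L ⟶ L') :
    HomologicalComplex.mapBifunctorMap (𝟙 ((single M)⟦m⟧)) f (curriedTensor C) (ComplexShape.up ℤ) ≫
        (CochainComplex.mapBifunctorShift₁Iso (single M) L' (curriedTensor C) m).hom =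
      (CochainComplex.mapBifunctorShift₁Iso (single M) L (curriedTensor C) m).hom ≫
        (HomologicalComplex.mapBifunctorMap (𝟙 (single M)) f (curriedTensor C)
          (ComplexShape.up ℤ))⟦m⟧' := by
  ext n p q h
  refine (HomologicalComplex.ι_mapBifunctorMap_assoc (𝟙 ((single M)⟦m⟧)) f (curriedTensor C)
    (ComplexShape.up ℤ) p q n h _).trans ?_
  refine Eq.trans ?_ (CochainComplex.ι_mapBifunctorShift₁Iso_hom_f_assoc (single M) L
    (curriedTensor C) m p q n h (p + m) (n + m) rfl rfl _).symm
  have h3 := CochainComplex.ι_mapBifunctorShift₁Iso_hom_f (single M) L' (curriedTensor C) m p q n h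
    (p + m) (n + m) rfl rfl
  have h4 := HomologicalComplex.ι_mapBifunctorMap (𝟙 (single M)) f (curriedTensor C)
    (ComplexShape.up ℤ) (p + m) q (n + m) (show p + m + q = n + m by
      have : p + q = n := h
      omega)
  have key (X Y : C) {Z : C} (g : X ⊗ Y ⟶ Z) : ((curriedTensor C).map (𝟙 X)).app Y ≫ g = g := by
    simp
  have h3' := h3.trans ((key _ _ _).trans (Category.comp_id _))
  have h4' := h4.trans (key _ _ _)
  refine (key _ _ _).trans ?_
  refine Eq.trans ?_ (key _ _ _).symm
  refine Eq.trans ?_ (congrArg _ (Category.id_comp _).symm)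
  refine Eq.trans ?_ h4'.symm
  exact congrArg (fun t => ((curriedTensor C).obj (((single M)⟦m⟧).X p)).map (f.f q) ≫ t) h3'

/-- `M[m] ⊗ -` is termwise `M ⊗ -` followed by the shift by `m`. -/
noncomputable def tensorStalkNatIso (M : C) (m : ℤ) :
    tensorComplex (stalk M m) ≅ (tensorLeft M).mapHomologicalComplex (ComplexShape.up ℤ) ⋙
      shiftFunctor (CochainComplex C ℤ) m :=
  (NatIso.ofComponents (F := tensorComplex (stalk M m))
    (G := tensorComplex (single M) ⋙ shiftFunctor (CochainComplex C ℤ) m)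
    (fun L => CochainComplex.mapBifunctorShift₁Iso (single M) L (curriedTensor C) m)
    (fun f => shiftIso_naturality M m f)) ≪≫
    Functor.isoWhiskerRight (tensorSingleNatIso M) (shiftFunctor (CochainComplex C ℤ) m)

section Derived
variable [HasDerivedCategory.{w} C]

/-- The functor `K ⊗ -` on complexes sends quasi-isomorphisms to quasi-isomorphisms. -/
def InvertsQuasiIso (K : CochainComplex C ℤ)
    [∀ L : CochainComplex C ℤ, HomologicalComplex.HasTensor K L] : Prop :=
  (HomologicalComplex.quasiIso C (ComplexShape.up ℤ)).IsInvertedBy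
    (tensorComplex K ⋙ DerivedCategory.Q)

/-- The functor `K ⊗ -` on the derived category, induced by the tensor product of complexes. -/
noncomputable def derivedTensor (K : CochainComplex C ℤ)
    [∀ L : CochainComplex C ℤ, HomologicalComplex.HasTensor K L] (hK : InvertsQuasiIso K) :
    DerivedCategory C ⥤ DerivedCategory C :=
  Localization.lift (tensorComplex K ⋙ DerivedCategory.Q) hK DerivedCategory.Q

variable (M : C) (m : ℤ) [PreservesFiniteLimits (tensorLeft M)]
  [PreservesFiniteColimits (tensorLeft M)]

/-- `tensorStalkNatIso`, read in the derived category. -/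
noncomputable def tensorStalkCompQIso :
    tensorComplex (stalk M m) ⋙ DerivedCategory.Q ≅ DerivedCategory.Q ⋙
      ((tensorLeft M).mapDerivedCategory ⋙ shiftFunctor (DerivedCategory C) m) :=
  Functor.isoWhiskerRight (tensorStalkNatIso M m) _ ≪≫ Functor.associator _ _ _ ≪≫
    Functor.isoWhiskerLeft _ (DerivedCategory.Q.commShiftIso m) ≪≫
    (Functor.associator _ _ _).symm ≪≫
    Functor.isoWhiskerRight (tensorLeft M).mapDerivedCategoryFactors.symm _ ≪≫
    Functor.associator _ _ _

lemma invertsQuasiIso_stalk : InvertsQuasiIso (stalk M m) := by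
  refine (MorphismProperty.IsInvertedBy.iff_of_iso _ (tensorStalkCompQIso M m)).2 ?_
  exact MorphismProperty.IsInvertedBy.of_comp _ _ (Localization.inverts _ _) _

/-- On the derived category, `M[m] ⊗ -` is isomorphic to the functor induced by the exact functor
`M ⊗ -`, followed by the shift by `m`. -/
noncomputable def derivedTensorStalkIso :
    derivedTensor (stalk M m) (invertsQuasiIso_stalk M m) ≅
      (tensorLeft M).mapDerivedCategory ⋙ shiftFunctor (DerivedCategory C) m :=
  letI : Localization.Lifting DerivedCategory.Q
      (HomologicalComplex.quasiIso C (ComplexShape.up ℤ)) (tensorComplex (stalk M m) ⋙ DerivedCategory.Q)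
      (derivedTensor (stalk M m) (invertsQuasiIso_stalk M m)) :=
    Localization.liftingLift _ (invertsQuasiIso_stalk M m) _
  Localization.liftNatIso DerivedCategory.Q (HomologicalComplex.quasiIso C (ComplexShape.up ℤ))
    (tensorComplex (stalk M m) ⋙ DerivedCategory.Q)
    (DerivedCategory.Q ⋙
      ((tensorLeft M).mapDerivedCategory ⋙ shiftFunctor (DerivedCategory C) m)) _ _
    (tensorStalkCompQIso M m)

lemma bounded_derivedTensor_stalk (X : DerivedCategory C)
    (hX : DerivedCategory.TStructure.t.bounded X) :
    DerivedCategory.TStructure.t.bounded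
      ((derivedTensor (stalk M m) (invertsQuasiIso_stalk M m)).obj X) := by
  refine ObjectProperty.prop_of_iso _ ((derivedTensorStalkIso M m).app X).symm ?_
  refine ObjectProperty.le_shift _ m _ ?_
  obtain ⟨⟨a, K, e, hK⟩, ⟨b, L, f, hL⟩⟩ := hX
  exact ⟨⟨a, ((tensorLeft M).mapHomologicalComplex _).obj K,
      (tensorLeft M).mapDerivedCategory.mapIso e ≪≫ (tensorLeft M).mapDerivedCategoryFactors.app K,
      inferInstance⟩,
    ⟨b, ((tensorLeft M).mapHomologicalComplex _).obj L,
      (tensorLeft M).mapDerivedCategory.mapIso f ≪≫ (tensorLeft M).mapDerivedCategoryFactors.app L,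
      inferInstance⟩⟩

/-- The endofunctor `M[m] ⊗ -` of the bounded derived category. -/
noncomputable def boundedTensorStalk : DerivedCategory.Bounded C ⥤ DerivedCategory.Bounded C :=
  DerivedCategory.TStructure.t.bounded.lift
    (DerivedCategory.Bounded.ι ⋙ derivedTensor (stalk M m) (invertsQuasiIso_stalk M m))
    fun X => bounded_derivedTensor_stalk M m _ X.property

end Derived

end StalkTensor

/-! ## The Frobenius-Perron dimension -/

namespace FrobeniusPerron

variable {C : Type u} [Category.{v} C] (k : Type*) [Field k] [Preadditive C] [Linear k C]

/-- `X` is a brick: `Hom(X, X) = k`, that is, every endomorphism is a unique multiple of the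
identity. -/
def IsBrick (X : C) : Prop := Function.Bijective fun c : k => c • 𝟙 X

/-- The finite family `X` is a brick set: all `X i` are bricks, and there are no nonzero morphisms
between distinct members (so its members are pairwise non-isomorphic). -/
def IsBrickSet {r : ℕ} (X : Fin r → C) : Prop :=
  (∀ i, IsBrick k (X i)) ∧ ∀ i j, i ≠ j → ∀ f : X i ⟶ X j, f = 0

/-- The adjacency matrix `(dim Hom(X i, σ (X j)))` of the family `X` and the endofunctor `σ`.
All Hom spaces are finite dimensional in the categories in which it is used. -/
noncomputable def adjacencyMatrix {r : ℕ} (X : Fin r → C) (σ : C ⥤ C) :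
    Matrix (Fin r) (Fin r) ℂ :=
  Matrix.of fun i j => (Module.finrank k (X i ⟶ σ.obj (X j)) : ℂ)

/-- The Frobenius-Perron dimension of the endofunctor `σ`: the supremum over all finite brick sets
of the spectral radius of the adjacency matrix, with values in `[0, ∞]`. -/
noncomputable def fpd (σ : C ⥤ C) : ℝ≥0∞ :=
  ⨆ (r : ℕ) (X : Fin r → C) (_ : IsBrickSet k X), spectralRadius ℂ (adjacencyMatrix k X σ)

end FrobeniusPerron

/-- The Frobenius-Perron dimension `fpd(M[m])` of the object `M[m]` of the monoidal category
`D^b(FinRep k V)`, that is, of the endofunctor `M[m] ⊗ -`. -/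
noncomputable def fpdStalk (k : Type u) [Field k] {V : Type} [Quiver.{0} V]
    [HasDerivedCategory.{w} (FinRep k V)] (M : FinRep k V) (m : ℤ) : ℝ≥0∞ :=
  FrobeniusPerron.fpd k (StalkTensor.boundedTensorStalk M m)

/-!
The category `FinRep k V` is hereditary: the left adjoints of the evaluations at vertices provide
enough projectives, and subrepresentations of projective representations are projective. A
truncation triangle of a complex in the derived category therefore splits, and each brick of `D^b`
is a stalk complex of a brick of `FinRep k V`
(`DerivedCategory.exists_iso_singleFunctor_of_isBrick`). The endofunctor `M[m] ⊗ -` sends stalk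
complexes to stalk complexes, so the entries of adjacency matrices are dimensions of `Hom(N, M ⊗
N')` or of `Ext¹(N, M ⊗ N')`, or zero, depending on the degrees.

For the quiver of type `Aₙ`, the Euler form is positive definite, so that it identifies the
dimension vector of a brick as the indicator function of an interval; the bricks are the interval
modules `M{s,t}` (`FinRep.exists_isInterval_of_isBrick`). Tensor products of interval modules are
interval modules of the intersection. The ends of intervals carry integers, `leftKey` and
`rightKey`, such that for intersecting intervals `Hom(M{s,t}, M{s',t'})` is `k` if both keys of
`(s,t)` are at most those of `(s',t')`, and `Ext¹(M{s,t}, M{s',t'})` is `k` if both are strictly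
greater; otherwise these spaces vanish. This follows by comparing the Euler form, which counts `1 -
[left key drops] - [right key drops]`, with the vanishing of `Hom` if one of the keys drops.

The upper bounds come from level functions on intervals which are monotone along the nonzero entries
of adjacency matrices. The degree of a stalk complex is the coarsest level, and in each degree a
combination of keys is used, chosen according to whether `M{i,j}` is a sink, a source or a flow
(`FinRep.fpdStalk_le`). The matrices are then block triangular, and the spectral radius is at most
the largest row sum of a diagonal block. These blocks vanish, or are of size one, or belong to
orthogonal intervals which all contain `[i, j]` (for a source), or which all extend `[i, j]` on both
sides (for a sink in degree one). Orthogonal intervals through a common vertex have distinct left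
ends and distinct right ends, which bounds their number. Conversely, intervals with increasing left
keys and decreasing right keys form a brick set, and if all of them contain `[i, j]` (for a source),
or extend it on both sides (for a sink in degree one), then all entries of the adjacency matrix are
`1` (`FinRep.le_fpdStalk`).
-/

/-! ### Spectral radii of nonnegative integer matrices -/

lemma Matrix.exists_mulVec_eq_smul_of_mem_spectrum {ι : Type*} [Fintype ι] [DecidableEq ι]
    {A : Matrix ι ι ℂ} {μ : ℂ} (h : μ ∈ spectrum ℂ A) : ∃ v ≠ 0, A.mulVec v = μ • v := by
  rw [spectrum.mem_iff, Matrix.isUnit_iff_isUnit_det, isUnit_iff_ne_zero, not_not,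
    ← Matrix.exists_mulVec_eq_zero_iff] at h
  obtain ⟨v, hv, h⟩ := h
  refine ⟨v, hv, ?_⟩
  rw [Matrix.sub_mulVec, sub_eq_zero, Algebra.algebraMap_eq_smul_one, Matrix.smul_mulVec,
    Matrix.one_mulVec] at h
  exact h.symm

lemma Matrix.mem_spectrum_of_mulVec_eq_smul {ι : Type*} [Fintype ι] [DecidableEq ι]
    {A : Matrix ι ι ℂ} {μ : ℂ} {v : ι → ℂ} (hv : v ≠ 0) (h : A.mulVec v = μ • v) :
    μ ∈ spectrum ℂ A := by
  rw [spectrum.mem_iff, Matrix.isUnit_iff_isUnit_det, isUnit_iff_ne_zero, not_not,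
    ← Matrix.exists_mulVec_eq_zero_iff]
  refine ⟨v, hv, ?_⟩
  rw [Matrix.sub_mulVec, Algebra.algebraMap_eq_smul_one, Matrix.smul_mulVec,
    Matrix.one_mulVec, h, sub_self]

/-- A nonnegative integer matrix which is block triangular with respect to the levels of `φ` has
spectral radius at most `R` if all row sums of its diagonal blocks are at most `R`: restrict an
eigenvector to the lowest level on which it does not vanish. -/
lemma Matrix.spectralRadius_le_of_level {ι β : Type*} [Fintype ι] [DecidableEq ι] [LinearOrder β]
    (A : Matrix ι ι ℕ) (φ : ι → β) (R : ℕ) (hφ : ∀ a b, A a b ≠ 0 → φ b ≤ φ a)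
    (hR : ∀ a, ∑ b with φ b = φ a, A a b ≤ R) :
    spectralRadius ℂ (A.map ((↑) : ℕ → ℂ)) ≤ R := by
  refine iSup₂_le fun μ hμ => ?_
  obtain ⟨v, hv, h⟩ := Matrix.exists_mulVec_eq_smul_of_mem_spectrum hμ
  obtain ⟨c, hc, hmin⟩ := Finset.exists_min_image (Finset.univ.filter fun a => v a ≠ 0) φ (by
    obtain ⟨a, ha⟩ := Function.ne_iff.1 hv
    exact ⟨a, by simpa using ha⟩)
  have hlow : ∀ b, φ b < φ c → v b = 0 := fun b hb => by
    by_contra hne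
    exact absurd (hmin b (by simpa using hne)) (not_le.2 hb)
  obtain ⟨a, ha, hmax⟩ := Finset.exists_max_image (Finset.univ.filter fun a => φ a = φ c)
    (fun a => ‖v a‖) ⟨c, by simp⟩
  have hac : φ a = φ c := by simpa using ha
  have hva : 0 < ‖v a‖ :=
    lt_of_lt_of_le (norm_pos_iff.2 (by simpa using hc)) (hmax c (by simp))
  have hsum : μ * v a = ∑ b with φ b = φ a, (A a b : ℂ) * v b := by
    have h1 := (congrFun h a).symm
    rw [Pi.smul_apply, smul_eq_mul] at h1
    rw [h1, Finset.sum_filter]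
    refine Finset.sum_congr rfl fun b _ => ?_
    split_ifs with hb
    · rfl
    · by_cases hA : A a b = 0
      · simp [hA]
      · rw [hlow b (hac ▸ lt_of_le_of_ne (hφ a b hA) hb), mul_zero]
  have hle : ‖μ‖ * ‖v a‖ ≤ R * ‖v a‖ := by
    rw [← norm_mul, hsum]
    calc ‖∑ b with φ b = φ a, (A a b : ℂ) * v b‖
        ≤ ∑ b with φ b = φ a, (A a b : ℝ) * ‖v a‖ := by
          refine norm_sum_le_of_le _ fun b hb => ?_
          rw [norm_mul, Complex.norm_natCast]
          refine mul_le_mul_of_nonneg_left (hmax b ?_) (Nat.cast_nonneg _)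
          simpa [hac] using hb
      _ = ((∑ b with φ b = φ a, A a b : ℕ) : ℝ) * ‖v a‖ := by
          rw [← Finset.sum_mul, Nat.cast_sum]
      _ ≤ R * ‖v a‖ := by
          gcongr
          exact hR a
  have hle' : ‖μ‖₊ ≤ (R : NNReal) := by
    rw [← NNReal.coe_le_coe]
    simpa using le_of_mul_le_mul_right hle hva
  exact_mod_cast hle'

lemma Matrix.le_spectralRadius_of_forall_eq_one {r : ℕ} (A : Matrix (Fin r) (Fin r) ℕ)
    (hA : ∀ a b, A a b = 1) : (r : ℝ≥0∞) ≤ spectralRadius ℂ (A.map ((↑) : ℕ → ℂ)) := by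
  rcases Nat.eq_zero_or_pos r with rfl | hr
  · simp
  have h : (r : ℂ) ∈ spectrum ℂ (A.map ((↑) : ℕ → ℂ)) := by
    refine Matrix.mem_spectrum_of_mulVec_eq_smul (v := fun _ => 1)
      (fun h0 => one_ne_zero (congrFun h0 ⟨0, hr⟩)) ?_
    ext a
    simp [Matrix.mulVec, dotProduct, hA]
  refine le_trans ?_ (le_iSup₂ (f := fun (μ : ℂ) (_ : μ ∈ spectrum ℂ (A.map ((↑) : ℕ → ℂ))) =>
    ((‖μ‖₊ : NNReal) : ℝ≥0∞)) (r : ℂ) h)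
  simp

/-! ### The derived category of a hereditary abelian category -/

/-- Every object is a quotient of a projective object by a projective subobject; in other words,
there are enough projectives and all projective dimensions are at most one. -/
def HasTwoTermProjectiveResolutions (C : Type u) [Category.{v} C] [Abelian C] : Prop :=
  ∀ N : C, ∃ (P : C) (π : P ⟶ N), Projective P ∧ Epi π ∧ Projective (kernel π)

lemma CategoryTheory.ShortComplex.shortExact_kernel {C : Type u} [Category.{v} C] [Abelian C]
    {P N : C} (π : P ⟶ N) [Epi π] :
    (ShortComplex.mk (kernel.ι π) π (kernel.condition π)).ShortExact where
  exact := ShortComplex.exact_kernel π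
  mono_f := inferInstance
  epi_g := ‹_›

namespace DerivedCategory

open Pretriangulated

variable {C : Type u} [Category.{v} C] [Abelian C] [HasDerivedCategory.{w} C]

lemma singleFunctor_hom_eq_zero_of_projective {P : C} [Projective P] {B : DerivedCategory C}
    {b : ℤ} (n : ℤ) (h : n < b) [B.IsLE n] (f : (singleFunctor C b).obj P ⟶ B) : f = 0 := by
  obtain ⟨L, _, ⟨e⟩⟩ := B.exists_iso_Q_obj_of_isLE n
  let e' := (singleFunctorIsoCompQ C b).app P
  have h0 := from_singleFunctor_obj_eq_zero_of_projective (e'.inv ≫ f ≫ e.hom) n h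
  rw [← cancel_epi e'.inv, ← cancel_mono e.hom, Category.assoc, h0]
  simp

/-- The isomorphism between `N[1]`, for `N` in degree `0`, and the stalk complex `N` in degree
`-1`. -/
noncomputable def singleShiftOneIso (N : C) :
    ((singleFunctor C 0).obj N)⟦(1 : ℤ)⟧ ≅ (singleFunctor C (-1)).obj N :=
  ((singleFunctors C).shiftIso 1 (-1) 0 (by simp)).app N

lemma exists_distinguished_kernel {P N : C} (π : P ⟶ N) [Epi π] :
    ∃ δ : (singleFunctor C 0).obj N ⟶ ((singleFunctor C 0).obj (kernel π))⟦(1 : ℤ)⟧,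
      Triangle.mk ((singleFunctor C 0).map (kernel.ι π)) ((singleFunctor C 0).map π) δ ∈
        distTriang (DerivedCategory C) :=
  ⟨_, (ShortComplex.shortExact_kernel π).singleTriangle_distinguished⟩

/-- If all projective dimensions are at most one, there are no nonzero morphisms from a stalk
complex in degree `b` to an object whose cohomology lives in degrees at most `b - 2`. -/
lemma singleFunctor_hom_eq_zero (hC : HasTwoTermProjectiveResolutions C) {N : C}
    {B : DerivedCategory C} {b : ℤ} (n : ℤ) (h : n + 2 ≤ b) [B.IsLE n]
    (f : (singleFunctor C b).obj N ⟶ B) : f = 0 := by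
  have main : ∀ {B : DerivedCategory C} (n : ℤ) (_ : n + 2 ≤ 0) [B.IsLE n]
      (f : (singleFunctor C 0).obj N ⟶ B), f = 0 := by
    intro B n h _ f
    obtain ⟨P, π, _, _, _⟩ := hC N
    obtain ⟨δ, hT⟩ := exists_distinguished_kernel π
    obtain ⟨g, hg⟩ : ∃ g : ((singleFunctor C 0).obj (kernel π))⟦(1 : ℤ)⟧ ⟶ B, f = δ ≫ g :=
      Triangle.yoneda_exact₃ _ hT f (singleFunctor_hom_eq_zero_of_projective n (by lia) _)
    have hg' : g = 0 := by
      rw [← cancel_epi (singleShiftOneIso (kernel π)).inv, comp_zero]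
      exact singleFunctor_hom_eq_zero_of_projective n (by lia) _
    rw [hg, hg', comp_zero]
  let e := ((singleFunctors C).shiftIso b 0 b (by simp)).app N
  have : (B⟦b⟧).IsLE (n - b) := TStructure.t.isLE_shift B n b (n - b)
  have h0 : e.inv ≫ f⟦b⟧' = 0 := main (n - b) (by lia) _
  refine (shiftFunctor (DerivedCategory C) b).map_injective ?_
  rw [← cancel_epi e.inv, h0]
  simp

section Linear

variable (k : Type*) [Field k] [Linear k C]

/-- A fully faithful linear functor induces linear isomorphisms on Hom spaces. -/
noncomputable def _root_.CategoryTheory.Functor.mapLinearEquiv {D E : Type*} [Category* D]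
    [Category* E] [Preadditive D] [Preadditive E] [Linear k D] [Linear k E] (F : D ⥤ E)
    [F.Additive] [F.Linear k] [F.Full] [F.Faithful] (X Y : D) :
    (X ⟶ Y) ≃ₗ[k] (F.obj X ⟶ F.obj Y) :=
  LinearEquiv.ofBijective (F.mapLinearMap k) ⟨F.map_injective, F.map_surjective⟩

lemma nonempty_singleHomShift (N N' : C) (a b d : ℤ) :
    Nonempty (((singleFunctor C (d + a)).obj N ⟶ (singleFunctor C (d + b)).obj N') ≃ₗ[k]
      ((singleFunctor C a).obj N ⟶ (singleFunctor C b).obj N')) :=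
  ⟨(Functor.mapLinearEquiv k (shiftFunctor (DerivedCategory C) d) _ _).trans
    (Linear.homCongr k (((singleFunctors C).shiftIso d a (d + a) rfl).app N)
      (((singleFunctors C).shiftIso d b (d + b) rfl).app N'))⟩

/-- The dimension of `Ext¹(N, N')`, as a Hom space of the derived category. -/
noncomputable def extDim (N N' : C) : ℕ :=
  Module.finrank k ((singleFunctor C 0).obj N ⟶ (singleFunctor C (-1)).obj N')

lemma finrank_singleFunctor_hom_self (N N' : C) (d : ℤ) :
    Module.finrank k ((singleFunctor C d).obj N ⟶ (singleFunctor C d).obj N') =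
      Module.finrank k (N ⟶ N') :=
  (Functor.mapLinearEquiv k (singleFunctor C d) N N').finrank_eq.symm

lemma finrank_singleFunctor_hom_sub_one (N N' : C) (d e : ℤ) (h : e + 1 = d) :
    Module.finrank k ((singleFunctor C d).obj N ⟶ (singleFunctor C e).obj N') =
      extDim k N N' := by
  obtain ⟨φ⟩ := nonempty_singleHomShift k N N' 0 (-1) d
  have h1 : d + 0 = d := by lia
  have h2 : d + -1 = e := by lia
  rw [h1, h2] at φ
  exact φ.finrank_eq

lemma finrank_singleFunctor_hom_eq_zero (hC : HasTwoTermProjectiveResolutions C) (N N' : C)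
    (d e : ℤ) (h0 : e ≠ d) (h1 : e + 1 ≠ d) :
    Module.finrank k ((singleFunctor C d).obj N ⟶ (singleFunctor C e).obj N') = 0 := by
  have : Subsingleton ((singleFunctor C d).obj N ⟶ (singleFunctor C e).obj N') := by
    refine subsingleton_of_forall_eq 0 fun f => ?_
    rcases lt_or_ge d e with h | h
    · exact TStructure.t.zero f d e h
    · exact singleFunctor_hom_eq_zero hC e (by lia) f
  exact Module.finrank_zero_of_subsingleton

variable {k}

/-- The Euler characteristic of the long exact sequence obtained by applying `Hom(-, N')` to a
projective presentation of length one. -/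
lemma extDim_add {P N : C} (π : P ⟶ N) [Epi π] [Projective P] (N' : C)
    [Module.Finite k (P ⟶ N')] [Module.Finite k (kernel π ⟶ N')] :
    extDim k N N' + Module.finrank k (P ⟶ N') =
      Module.finrank k (N ⟶ N') + Module.finrank k (kernel π ⟶ N') := by
  have hS := ShortComplex.shortExact_kernel π
  obtain ⟨d, hT⟩ := exists_distinguished_kernel π
  let e := singleShiftOneIso N'
  let S := shiftFunctor (DerivedCategory C) (1 : ℤ)
  let F := singleFunctor C 0
  let r : (P ⟶ N') →ₗ[k] (kernel π ⟶ N') := Linear.leftComp k N' (kernel.ι π)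
  let q : (N ⟶ N') →ₗ[k] (P ⟶ N') := Linear.leftComp k N' π
  let δ : (kernel π ⟶ N') →ₗ[k]
      ((singleFunctor C 0).obj N ⟶ (singleFunctor C (-1)).obj N') :=
    (Linear.rightComp k _ e.hom).comp ((Linear.leftComp k _ d).comp
      (S.mapLinearMap k |>.comp (F.mapLinearMap k)))
  have hδ : ∀ f, δ f = (d ≫ S.map (F.map f)) ≫ e.hom := fun f => rfl
  have hδsurj : Function.Surjective δ := by
    intro x
    obtain ⟨g, hg⟩ : ∃ g : S.obj (F.obj (kernel π)) ⟶ S.obj (F.obj N'), x ≫ e.inv = d ≫ g :=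
      Triangle.yoneda_exact₃ _ hT (x ≫ e.inv) (by
        have : F.map π ≫ x = 0 :=
          singleFunctor_hom_eq_zero_of_projective (-1) (by lia) _
        change F.map π ≫ x ≫ e.inv = 0
        rw [← Category.assoc, this, zero_comp])
    obtain ⟨g, rfl⟩ := S.map_surjective g
    obtain ⟨f, rfl⟩ := F.map_surjective g
    exact ⟨f, by rw [hδ, ← hg, Category.assoc, e.inv_hom_id, Category.comp_id]⟩
  have hker : LinearMap.ker δ = LinearMap.range r := by
    ext f
    constructor
    · intro hf
      have hf' : d ≫ S.map (F.map f) = 0 := by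
        rw [← cancel_mono e.hom, ← hδ, zero_comp]
        exact hf
      obtain ⟨g, hg⟩ : ∃ g : S.obj (F.obj P) ⟶ S.obj (F.obj N'),
          S.map (F.map f) = (-S.map (F.map (kernel.ι π))) ≫ g :=
        Triangle.yoneda_exact₃ _ (rot_of_distTriang _ hT) _ hf'
      obtain ⟨g, rfl⟩ := S.map_surjective g
      obtain ⟨g, rfl⟩ := F.map_surjective g
      refine ⟨-g, F.map_injective (S.map_injective ?_)⟩
      rw [hg]
      change S.map (F.map (kernel.ι π ≫ (-g))) = _
      simp
    · rintro ⟨g, rfl⟩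
      have h1 : d ≫ S.map (F.map (kernel.ι π)) = 0 := comp_distTriang_mor_zero₃₁ _ hT
      rw [LinearMap.mem_ker, hδ]
      change (d ≫ S.map (F.map (kernel.ι π ≫ g))) ≫ e.hom = 0
      rw [F.map_comp, S.map_comp, reassoc_of% h1]
      simp
  have hrker : LinearMap.ker r = LinearMap.range q := by
    ext f
    constructor
    · intro hf
      have hf' : kernel.ι π ≫ f = 0 := hf
      exact ⟨hS.exact.desc f hf', hS.exact.g_desc f hf'⟩
    · rintro ⟨g, rfl⟩
      change kernel.ι π ≫ π ≫ g = 0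
      simp
  have hqinj : Function.Injective q := fun f g hfg => (cancel_epi π).1 hfg
  have : Module.Finite k (N ⟶ N') := Module.Finite.of_injective q hqinj
  have e1 := LinearMap.finrank_range_add_finrank_ker δ
  have e2 := LinearMap.finrank_range_add_finrank_ker r
  rw [LinearMap.range_eq_top.2 hδsurj, finrank_top, hker] at e1
  rw [hrker, LinearMap.finrank_range_of_inj hqinj] at e2
  have e3 : extDim k N N' = Module.finrank k
    ((singleFunctor C 0).obj N ⟶ (singleFunctor C (-1)).obj N') := rfl
  omega

variable (k) in
/-- In the bounded derived category of a hereditary abelian category, every brick is a stalk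
complex: the truncation triangle at the top nonzero cohomology splits, since its connecting
morphism vanishes, and a brick is indecomposable. -/
lemma exists_iso_singleFunctor_of_isBrick (hC : HasTwoTermProjectiveResolutions C)
    (X : DerivedCategory C) (hX : FrobeniusPerron.IsBrick k X)
    (hb : TStructure.t.bounded X) :
    ∃ (d : ℤ) (N : C), Nonempty (X ≅ (singleFunctor C d).obj N) := by
  obtain ⟨⟨a, ha⟩, ⟨b₀, hb₀⟩⟩ := hb
  have hne : ¬ IsZero X := fun h0 => by
    have := hX.1 (a₁ := 1) (a₂ := 0) (h0.eq_of_src _ _)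
    exact one_ne_zero this
  obtain ⟨b, hb, hmin⟩ := Int.exists_least_of_bdd (P := fun b => X.IsLE b)
    ⟨a, fun b hb => by
      by_contra hlt
      have : X.IsLE b := hb
      exact hne (TStructure.t.isZero X b a (not_le.1 hlt))⟩ ⟨b₀, hb₀⟩
  obtain ⟨A, B, hA, hB, i, p, δ, hT⟩ := TStructure.t.exists_triangle X (b - 1) b (by lia)
  have : X.IsLE b := hb
  have hA' : A.IsLE (b - 1) := ⟨hA⟩
  have hB' : B.IsGE b := ⟨hB⟩
  have hA1 : (A⟦(1 : ℤ)⟧).IsLE (b - 2) := TStructure.t.isLE_shift A (b - 1) 1 (b - 2)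
  have hBle : B.IsLE b := TStructure.t.isLE₂ _ (rot_of_distTriang _ hT) b hb
    (TStructure.t.isLE_of_le (A⟦(1 : ℤ)⟧) (b - 2) b)
  obtain ⟨N, ⟨e⟩⟩ := exists_iso_singleFunctor_obj_of_isGE_of_isLE B b
  have hδ : δ = 0 := by
    rw [← cancel_epi e.inv, comp_zero]
    exact singleFunctor_hom_eq_zero hC (b - 2) (by lia) _
  have : Epi p := Triangle.epi₂ _ hT hδ
  have hsplit := isSplitEpi_of_epi p
  let s := section_ p
  have hs : s ≫ p = 𝟙 B := IsSplitEpi.id p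
  obtain ⟨c, hc⟩ := hX.2 (p ≫ s)
  have hc' : c • 𝟙 X = p ≫ s := hc
  have hcp : c • p = p := by
    have := congrArg (· ≫ p) hc'
    simpa [hs] using this
  by_cases hB0 : IsZero B
  · have : IsIso i := (Triangle.isZero₃_iff_isIso₁ _ hT).1 hB0
    have h1 := hmin (b - 1) (TStructure.t.isLE_of_iso (asIso i) (b - 1))
    lia
  · have hc1 : c = 1 := by
      by_contra hne1
      have hp : p = 0 := by
        have h2 : (c - 1) • p = 0 := by rw [sub_smul, one_smul, hcp, sub_self]
        exact (smul_eq_zero_iff_right (sub_ne_zero.2 hne1)).1 h2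
      apply hB0
      rw [IsZero.iff_id_eq_zero, ← hs, hp, comp_zero]
    rw [hc1, one_smul] at hc'
    exact ⟨b, N, ⟨⟨p, s, hc'.symm, hs⟩ ≪≫ e⟩⟩

end Linear

end DerivedCategory

/-! ### Tensoring stalk complexes, and the adjacency matrices of brick sets -/

namespace StalkTensor

open DerivedCategory FrobeniusPerron

variable {C : Type u} [Category.{v} C] [Abelian C] [MonoidalCategory C] [MonoidalPreadditive C]
  [HasDerivedCategory.{w} C] (M : C) (m : ℤ) [PreservesFiniteLimits (tensorLeft M)]
  [PreservesFiniteColimits (tensorLeft M)]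

/-- `M[m] ⊗ -` sends the stalk complex `N` in degree `d` to `M ⊗ N` in degree `d - m`. -/
lemma nonempty_boundedTensorStalk_iso (X : DerivedCategory.Bounded C) (N : C) (d : ℤ)
    (e : X.obj ≅ (singleFunctor C d).obj N) :
    Nonempty (((boundedTensorStalk M m).obj X).obj ≅ (singleFunctor C (d - m)).obj (M ⊗ N)) :=
  ⟨(derivedTensorStalkIso M m).app X.obj ≪≫
    (shiftFunctor (DerivedCategory C) m).mapIso ((tensorLeft M).mapDerivedCategory.mapIso e ≪≫
      ((tensorLeft M).mapDerivedCategorySingleFunctor d).app N) ≪≫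
    ((singleFunctors C).shiftIso m (d - m) d (by lia)).app (M ⊗ N)⟩

variable (k : Type*) [Field k] [Linear k C]

/-- The dimension of `Hom(N[-d], M[m] ⊗ N'[-d'])` for stalk complexes `N` in degree `d` and `N'` in
degree `d'`, when all projective dimensions are at most one. -/
noncomputable def stalkHomDim (d : ℤ) (N : C) (d' : ℤ) (N' : C) : ℕ :=
  if d' - m = d then Module.finrank k (N ⟶ M ⊗ N')
  else if d' - m + 1 = d then extDim k N (M ⊗ N') else 0

lemma finrank_hom_boundedTensorStalk (hC : HasTwoTermProjectiveResolutions C)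
    {X Y : DerivedCategory.Bounded C} {N N' : C} {d d' : ℤ}
    (e : X.obj ≅ (singleFunctor C d).obj N) (e' : Y.obj ≅ (singleFunctor C d').obj N') :
    Module.finrank k (X ⟶ (boundedTensorStalk M m).obj Y) = stalkHomDim M m k d N d' N' := by
  obtain ⟨e''⟩ := nonempty_boundedTensorStalk_iso M m Y N' d' e'
  rw [((Functor.mapLinearEquiv k (DerivedCategory.Bounded.ι (C := C)) X
    ((boundedTensorStalk M m).obj Y)).trans (Linear.homCongr k e e'')).finrank_eq, stalkHomDim]
  split_ifs with h1 h2
  · subst h1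
    exact finrank_singleFunctor_hom_self k _ _ _
  · exact finrank_singleFunctor_hom_sub_one k _ _ _ _ h2
  · exact finrank_singleFunctor_hom_eq_zero k hC _ _ _ _ h1 h2

variable {k} in
lemma _root_.FrobeniusPerron.IsBrick.of_iso {D : Type*} [Category* D] [Preadditive D] [Linear k D]
    {X Y : D} (h : IsBrick k X) (e : X ≅ Y) : IsBrick k Y := by
  have := (Linear.homCongr k e e).bijective.comp h
  have h' : (fun c : k => c • 𝟙 Y) = Linear.homCongr k e e ∘ fun c : k => c • 𝟙 X := by
    ext c
    simp [Linear.homCongr]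
  rwa [IsBrick, h']

variable {k} in
lemma _root_.FrobeniusPerron.isBrick_map_iff {D E : Type*} [Category* D] [Preadditive D]
    [Linear k D] [Category* E] [Preadditive E] [Linear k E] (F : D ⥤ E)
    [F.Additive] [F.Linear k] [F.Full] [F.Faithful] (X : D) :
    IsBrick k (F.obj X) ↔ IsBrick k X := by
  have h : (fun c : k => c • 𝟙 (F.obj X)) =
      Functor.mapLinearEquiv k F X X ∘ fun c : k => c • 𝟙 X := by
    ext c
    exact (by rw [Functor.map_smul, F.map_id] : c • 𝟙 (F.obj X) = F.map (c • 𝟙 X))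
  rw [IsBrick, IsBrick, h]
  exact (Functor.mapLinearEquiv k F X X).bijective.of_comp_iff' _

/-- To bound `fpd(M[m])` from above, it suffices to consider families of stalk complexes of
bricks which are orthogonal if they are in the same degree. -/
lemma fpd_boundedTensorStalk_le (hC : HasTwoTermProjectiveResolutions C) (R : ℝ≥0∞)
    (H : ∀ (r : ℕ) (d : Fin r → ℤ) (N : Fin r → C), (∀ a, IsBrick k (N a)) →
      (∀ a b, a ≠ b → d a = d b → ∀ f : N a ⟶ N b, f = 0) →
      spectralRadius ℂ ((Matrix.of fun a b => stalkHomDim M m k (d a) (N a) (d b) (N b)).map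
        ((↑) : ℕ → ℂ)) ≤ R) :
    fpd k (boundedTensorStalk M m) ≤ R := by
  refine iSup_le fun r => iSup₂_le fun X hX => ?_
  have hX1 : ∀ a, IsBrick k (X a).obj := fun a =>
    (isBrick_map_iff (DerivedCategory.Bounded.ι (C := C)) (X a)).2 (hX.1 a)
  choose d N e using fun a => exists_iso_singleFunctor_of_isBrick k hC (X a).obj (hX1 a)
    (X a).property
  have e := fun a => (e a).some
  have hN : ∀ a, IsBrick k (N a) := fun a =>
    (isBrick_map_iff (singleFunctor C (d a)) (N a)).1 ((hX1 a).of_iso (e a))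
  have hA : adjacencyMatrix k X (boundedTensorStalk M m) =
      (Matrix.of fun a b => stalkHomDim M m k (d a) (N a) (d b) (N b)).map ((↑) : ℕ → ℂ) := by
    ext a b
    simp only [adjacencyMatrix, Matrix.map_apply, Matrix.of_apply,
      finrank_hom_boundedTensorStalk M m k hC (e a) (e b)]
  rw [hA]
  refine H r d N hN ?_
  · intro a b hab hd f
    let φ := Functor.mapLinearEquiv k (DerivedCategory.Bounded.ι (C := C)) (X a) (X b)
    let g : (singleFunctor C (d a)).obj (N b) ≅ (singleFunctor C (d b)).obj (N b) := by
      rw [hd]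
    have h0 : (e a).hom ≫ (singleFunctor C (d a)).map f ≫ g.hom ≫ (e b).inv = 0 := by
      rw [← φ.apply_symm_apply ((e a).hom ≫ _), hX.2 a b hab (φ.symm _), map_zero]
    apply (singleFunctor C (d a)).map_injective
    rw [← cancel_epi (e a).hom, ← cancel_mono (g.hom ≫ (e b).inv), Category.assoc, h0]
    simp

/-- The stalk complex `N` in degree `0`, as an object of the bounded derived category. -/
noncomputable def boundedSingle (N : C) : DerivedCategory.Bounded C :=
  ⟨(singleFunctor C 0).obj N, ⟨⟨0, inferInstance⟩, ⟨0, inferInstance⟩⟩⟩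

/-- A brick set in the heart bounds `fpd(M[m])` from below. -/
lemma le_fpd_boundedTensorStalk (hC : HasTwoTermProjectiveResolutions C) {r : ℕ} (N : Fin r → C)
    (hN : IsBrickSet k N) :
    spectralRadius ℂ ((Matrix.of fun a b => stalkHomDim M m k 0 (N a) 0 (N b)).map
      ((↑) : ℕ → ℂ)) ≤ fpd k (boundedTensorStalk M m) := by
  have hX : IsBrickSet k fun a => boundedSingle (N a) := by
    refine ⟨fun a => ?_, fun a b hab f => ?_⟩
    · rw [← isBrick_map_iff (DerivedCategory.Bounded.ι (C := C))]
      exact (isBrick_map_iff (singleFunctor C 0) (N a)).2 (hN.1 a)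
    · apply (DerivedCategory.Bounded.ι (C := C)).map_injective
      obtain ⟨g, hg⟩ := (singleFunctor C 0).map_surjective
        ((DerivedCategory.Bounded.ι (C := C)).map f)
      rw [← hg, hN.2 a b hab g, Functor.map_zero, Functor.map_zero]
      rfl
  refine le_trans (le_of_eq ?_) (le_iSup_of_le r (le_iSup₂_of_le _ hX le_rfl))
  congr 1
  ext a b
  simp only [adjacencyMatrix, Matrix.map_apply, Matrix.of_apply,
    finrank_hom_boundedTensorStalk M m k hC (X := boundedSingle (N a)) (Y := boundedSingle (N b))
      (Iso.refl _) (Iso.refl _)]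

end StalkTensor

/-! ### Representations of a finite quiver without oriented cycles -/

namespace FinRep

variable {k : Type u} [Field k] {V : Type} [Quiver.{0} V]

/-- The vector space of a representation at a vertex. -/
def Vec (M : FinRep k V) (v : V) : Type u := FGModuleCat.carrier (M.obj (show Paths V from v))

namespace Vec

variable (M : FinRep k V) (v : V)

instance : AddCommGroup (M.Vec v) :=
  inferInstanceAs (AddCommGroup (M.obj (show Paths V from v)))

instance : Module k (M.Vec v) := inferInstanceAs (Module k (M.obj (show Paths V from v)))

instance : Module.Finite k (M.Vec v) :=
  inferInstanceAs (Module.Finite k (M.obj (show Paths V from v)))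

end Vec

/-- The linear map of a representation attached to an arrow. -/
def arrowMap (M : FinRep k V) {a b : V} (p : a ⟶ b) : M.Vec a →ₗ[k] M.Vec b :=
  (M.map (Quiver.Hom.toPath p)).hom.hom

/-- The linear map of a morphism of representations at a vertex. -/
def vertexMap {M N : FinRep k V} (f : M ⟶ N) (v : V) : M.Vec v →ₗ[k] N.Vec v :=
  (f.app v).hom.hom

lemma vertexMap_arrowMap {M N : FinRep k V} (f : M ⟶ N) {a b : V} (p : a ⟶ b) (x : M.Vec a) :
    vertexMap f b (M.arrowMap p x) = N.arrowMap p (vertexMap f a x) := by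
  have h := congrArg (fun g => g.hom.hom x) (f.naturality (Quiver.Hom.toPath p))
  exact h

lemma hom_ext_vertexMap {M N : FinRep k V} {f g : M ⟶ N}
    (h : ∀ v, vertexMap f v = vertexMap g v) : f = g := by
  ext v : 2
  exact FGModuleCat.hom_ext (h v)

@[simp] lemma vertexMap_id (M : FinRep k V) (v : V) : vertexMap (𝟙 M) v = LinearMap.id := rfl

@[simp] lemma vertexMap_comp {M N L : FinRep k V} (f : M ⟶ N) (g : N ⟶ L) (v : V) :
    vertexMap (f ≫ g) v = vertexMap g v ∘ₗ vertexMap f v := rfl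

@[simp] lemma vertexMap_zero {M N : FinRep k V} (v : V) :
    vertexMap (0 : M ⟶ N) v = 0 := rfl

@[simp] lemma vertexMap_smul {M N : FinRep k V} (c : k) (f : M ⟶ N) (v : V) :
    vertexMap (c • f) v = c • vertexMap f v := rfl

/-- A family of linear maps which is compatible with the arrows is a morphism. -/
def homMk {M N : FinRep k V} (g : ∀ v : V, M.Vec v →ₗ[k] N.Vec v)
    (h : ∀ {a b : V} (p : a ⟶ b), N.arrowMap p ∘ₗ g a = g b ∘ₗ M.arrowMap p) : M ⟶ N where
  app v := ObjectProperty.homMk (ModuleCat.ofHom (g v))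
  naturality a b p := by
    induction p using Paths.induction_fixed_source with
    | id => rw [M.map_id, N.map_id, Category.id_comp, Category.comp_id]
    | comp p q ih =>
      rw [M.map_comp, N.map_comp, Category.assoc, ← Category.assoc (M.map p), reassoc_of% ih.symm]
      rw [Category.assoc]
      congr 1
      apply FGModuleCat.hom_ext
      exact (h q).symm

@[simp] lemma vertexMap_homMk {M N : FinRep k V} (g : ∀ v : V, M.Vec v →ₗ[k] N.Vec v)
    (h : ∀ {a b : V} (p : a ⟶ b), N.arrowMap p ∘ₗ g a = g b ∘ₗ M.arrowMap p) (v : V) :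
    vertexMap (homMk g h) v = g v := rfl

/-- The representation with given vector spaces and linear maps. -/
def mk (W : V → Type u) [∀ v, AddCommGroup (W v)] [∀ v, Module k (W v)]
    [∀ v, Module.Finite k (W v)] (φ : ∀ {a b : V}, (a ⟶ b) → (W a →ₗ[k] W b)) : FinRep k V :=
  Paths.lift { obj := fun v => FGModuleCat.of k (W v), map := fun p => FGModuleCat.ofHom (φ p) }

lemma arrowMap_lift (F : V ⥤q FGModuleCat.{u} k) {a b : V} (p : a ⟶ b) :
    arrowMap (Paths.lift F) p = (F.map p).hom.hom := by
  rw [arrowMap, Paths.lift_toPath]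
  rfl

lemma arrowMap_mk (W : V → Type u) [∀ v, AddCommGroup (W v)] [∀ v, Module k (W v)]
    [∀ v, Module.Finite k (W v)] (φ : ∀ {a b : V}, (a ⟶ b) → (W a →ₗ[k] W b)) {a b : V}
    (p : a ⟶ b) : arrowMap (mk W φ) p = φ p := arrowMap_lift _ p

lemma vertexMap_surjective {M N : FinRep k V} (f : M ⟶ N) [Epi f] (v : V) :
    Function.Surjective (vertexMap f v) := by
  have h1 : Epi (f.app v) := (NatTrans.epi_iff_epi_app f).1 inferInstance v
  have h2 : Epi ((forget₂ (FGModuleCat k) (ModuleCat k)).map (f.app v)) := inferInstance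
  exact (ModuleCat.epi_iff_surjective _).1 h2

lemma epi_of_vertexMap_surjective {M N : FinRep k V} (f : M ⟶ N)
    (h : ∀ v, Function.Surjective (vertexMap f v)) : Epi f := by
  rw [NatTrans.epi_iff_epi_app]
  intro v
  refine (forget₂ (FGModuleCat k) (ModuleCat k)).epi_of_epi_map ?_
  exact (ModuleCat.epi_iff_surjective _).2 (h v)

lemma vertexMap_injective {M N : FinRep k V} (f : M ⟶ N) [Mono f] (v : V) :
    Function.Injective (vertexMap f v) := by
  have h1 : Mono (f.app v) := (NatTrans.mono_iff_mono_app f).1 inferInstance v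
  have h2 : Mono ((forget₂ (FGModuleCat k) (ModuleCat k)).map (f.app v)) := inferInstance
  exact (ModuleCat.mono_iff_injective _).1 h2

lemma finrank_kernel_add {M N : FinRep k V} (π : M ⟶ N) [Epi π] (v : V) :
    Module.finrank k (Vec (kernel π) v) + Module.finrank k (N.Vec v) =
      Module.finrank k (M.Vec v) := by
  let ev := (evaluation (Paths V) (FGModuleCat.{u} k)).obj (show Paths V from v)
  have : ev.PreservesZeroMorphisms := ⟨fun _ _ => rfl⟩
  have : PreservesFiniteLimits ev := ⟨fun J _ _ => inferInstanceAs (PreservesLimitsOfShape J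
    ((evaluation (Paths V) (FGModuleCat.{u} k)).obj (show Paths V from v)))⟩
  have : PreservesFiniteColimits ev := ⟨fun J _ _ => inferInstanceAs (PreservesColimitsOfShape J
    ((evaluation (Paths V) (FGModuleCat.{u} k)).obj (show Paths V from v)))⟩
  have hS := ((ShortComplex.shortExact_kernel π).map_of_exact ev).map_of_exact
      (forget₂ (FGModuleCat.{u} k) (ModuleCat.{u} k))
  have hex := (ShortComplex.ShortExact.moduleCat_exact_iff_function_exact _).1 hS.exact
  have hker : LinearMap.ker (vertexMap π v) = LinearMap.range (vertexMap (kernel.ι π) v) :=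
    LinearMap.exact_iff.1 hex
  have h := LinearMap.finrank_range_add_finrank_ker (vertexMap π v)
  rw [LinearMap.range_eq_top.2 (vertexMap_surjective π v), finrank_top, hker,
    LinearMap.finrank_range_of_inj (vertexMap_injective (kernel.ι π) v)] at h
  rw [← h, add_comm]

section Cochains

/-- The families of linear maps `X_v → Y_v`, for the vertices `v`. -/
abbrev VertexCochain (X Y : FinRep k V) : Type u := ∀ v : V, X.Vec v →ₗ[k] Y.Vec v

/-- The families of linear maps `X_a → Y_b`, for the arrows `a ⟶ b`. -/
abbrev ArrowCochain (X Y : FinRep k V) : Type u :=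
  ∀ p : (Σ (a : V) (b : V), (a ⟶ b)), X.Vec p.1 →ₗ[k] Y.Vec p.2.1

/-- The differential `g ↦ (Y_p g_a - g_b X_p)_{p : a ⟶ b}`, whose kernel is `Hom(X, Y)` and whose
cokernel is `Ext¹(X, Y)`. -/
def cochainDifferential (X Y : FinRep k V) : VertexCochain X Y →ₗ[k] ArrowCochain X Y where
  toFun g p := Y.arrowMap p.2.2 ∘ₗ g p.1 - g p.2.1 ∘ₗ X.arrowMap p.2.2
  map_add' g h := by
    ext p x
    simp only [LinearMap.sub_apply, LinearMap.comp_apply, Pi.add_apply, LinearMap.add_apply,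
      map_add]
    abel
  map_smul' c g := by
    ext p x
    simp only [LinearMap.sub_apply, LinearMap.comp_apply, Pi.smul_apply, LinearMap.smul_apply,
      map_smul, smul_sub, RingHom.id_apply]

lemma cochainDifferential_apply {X Y : FinRep k V} (g : VertexCochain X Y) {a b : V} (p : a ⟶ b)
    (x : X.Vec a) : cochainDifferential X Y g ⟨a, b, p⟩ x =
      Y.arrowMap p (g a x) - g b (X.arrowMap p x) := rfl

/-- Morphisms of representations are the vertex cochains killed by the differential. -/
def homEquivKer (X Y : FinRep k V) :
    (X ⟶ Y) ≃ₗ[k] LinearMap.ker (cochainDifferential X Y) where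
  toFun f := ⟨vertexMap f, by
    rw [LinearMap.mem_ker]
    funext p
    ext x
    exact sub_eq_zero.2 (vertexMap_arrowMap f p.2.2 x).symm⟩
  map_add' _ _ := rfl
  map_smul' _ _ := rfl
  invFun g := homMk g.1 (fun {a b} p =>
    sub_eq_zero.1 (congrFun (LinearMap.mem_ker.1 g.2) ⟨a, b, p⟩))
  left_inv f := hom_ext_vertexMap fun _ => rfl
  right_inv g := rfl

/-- The linear maps of the extension of `X` by `Y` with cocycle `c`. -/
def extensionMap {X Y : FinRep k V} (c : ArrowCochain X Y) {a b : V} (p : a ⟶ b) :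
    Y.Vec a × X.Vec a →ₗ[k] Y.Vec b × X.Vec b :=
  (Y.arrowMap p ∘ₗ LinearMap.fst k _ _ + c ⟨a, b, p⟩ ∘ₗ LinearMap.snd k _ _).prod
    (X.arrowMap p ∘ₗ LinearMap.snd k _ _)

/-- The extension of `X` by `Y` with cocycle `c`. -/
def extension {X Y : FinRep k V} (c : ArrowCochain X Y) : FinRep k V :=
  mk (fun v => Y.Vec v × X.Vec v) fun p => extensionMap c p

lemma arrowMap_extension {X Y : FinRep k V} (c : ArrowCochain X Y) {a b : V} (p : a ⟶ b)
    (x : Y.Vec a × X.Vec a) : (arrowMap (extension c) p x : Y.Vec b × X.Vec b) =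
      (Y.arrowMap p x.1 + c ⟨a, b, p⟩ x.2, X.arrowMap p x.2) :=
  LinearMap.congr_fun
    (arrowMap_mk (fun v => Y.Vec v × X.Vec v) (fun p => extensionMap c p) p) x

lemma cochainDifferential_surjective_of_projective (X Y : FinRep k V) [Projective X] :
    Function.Surjective (cochainDifferential X Y) := by
  intro c
  let π : extension c ⟶ X := homMk (fun v => LinearMap.snd k (Y.Vec v) (X.Vec v)) (by
    intro a b p
    ext x
    exact (congrArg Prod.snd (arrowMap_extension c p x)).symm)
  have : Epi π := epi_of_vertexMap_surjective π fun v x => ⟨(0, x), rfl⟩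
  let s := Projective.factorThru (𝟙 X) π
  have hs : s ≫ π = 𝟙 X := Projective.factorThru_comp _ _
  let s' : ∀ v : V, X.Vec v →ₗ[k] (Y.Vec v × X.Vec v) := fun v => vertexMap s v
  have hs' : ∀ (v : V) (x : X.Vec v), (s' v x).2 = x := fun v x =>
    congrArg (fun f : X ⟶ X => vertexMap f v x) hs
  refine ⟨fun v => -(LinearMap.fst k _ _ ∘ₗ s' v), ?_⟩
  funext ⟨a, b, p⟩
  ext x
  have h := (vertexMap_arrowMap s p x).trans (arrowMap_extension c p (s' a x))
  have h1 : (s' b (X.arrowMap p x)).1 = Y.arrowMap p (s' a x).1 + c ⟨a, b, p⟩ (s' a x).2 :=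
    congrArg Prod.fst h
  rw [cochainDifferential_apply]
  simp only [LinearMap.neg_apply, LinearMap.comp_apply, LinearMap.fst_apply, map_neg]
  rw [h1, hs']
  abel

/-- The restriction of the linear map of an arrow to the kernels of a morphism. -/
def kerMap {X Y : FinRep k V} (f : X ⟶ Y) {a b : V} (p : a ⟶ b) :
    LinearMap.ker (vertexMap f a) →ₗ[k] LinearMap.ker (vertexMap f b) :=
  (X.arrowMap p).restrict fun x hx => by
    rw [LinearMap.mem_ker] at hx ⊢
    rw [vertexMap_arrowMap, hx, map_zero]

/-- The kernel of a morphism of representations, computed vertex by vertex. -/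
def kerRep {X Y : FinRep k V} (f : X ⟶ Y) : FinRep k V :=
  mk (fun v => LinearMap.ker (vertexMap f v)) fun p => kerMap f p

lemma arrowMap_kerRep {X Y : FinRep k V} (f : X ⟶ Y) {a b : V} (p : a ⟶ b)
    (x : LinearMap.ker (vertexMap f a)) : arrowMap (kerRep f) p x = kerMap f p x :=
  LinearMap.congr_fun
    (arrowMap_mk (fun v => LinearMap.ker (vertexMap f v)) (fun p => kerMap f p) p) x

lemma projective_of_cochainDifferential_surjective (X : FinRep k V)
    (h : ∀ Y : FinRep k V, Function.Surjective (cochainDifferential X Y)) : Projective X where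
  factors {E Z} f e _ := by
    choose r hr using fun v => LinearMap.exists_rightInverse_of_surjective (vertexMap e v)
      (LinearMap.range_eq_top.2 (vertexMap_surjective e v))
    have hr' : ∀ (v : V) (z : Z.Vec v), vertexMap e v (r v z) = z := fun v z =>
      LinearMap.congr_fun (hr v) z
    let g : ∀ v : V, X.Vec v →ₗ[k] E.Vec v := fun v => r v ∘ₗ vertexMap f v
    -- The defect of the vertexwise lift `g` takes values in the kernel of `e`.
    let c : ArrowCochain X (kerRep e) := fun p =>
      (E.arrowMap p.2.2 ∘ₗ g p.1 - g p.2.1 ∘ₗ X.arrowMap p.2.2).codRestrict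
        (LinearMap.ker (vertexMap e p.2.1)) fun x => by
          rw [LinearMap.mem_ker, LinearMap.sub_apply, map_sub]
          simp only [LinearMap.comp_apply, g]
          rw [vertexMap_arrowMap, hr', hr', vertexMap_arrowMap, sub_self]
    obtain ⟨h', hh'⟩ := h (kerRep e) c
    let h'' : ∀ v : V, X.Vec v →ₗ[k] LinearMap.ker (vertexMap e v) := h'
    have key : ∀ {a b : V} (p : a ⟶ b) (x : X.Vec a),
        E.arrowMap p (h'' a x) - h'' b (X.arrowMap p x) =
          E.arrowMap p (g a x) - g b (X.arrowMap p x) := by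
      intro a b p x
      have h1 := congrArg Subtype.val (LinearMap.congr_fun (congrFun hh' ⟨a, b, p⟩) x)
      refine Eq.trans ?_ h1
      exact congrArg (fun y : LinearMap.ker (vertexMap e b) =>
        (y : E.Vec b) - (h'' b (X.arrowMap p x) : E.Vec b)) (arrowMap_kerRep e p (h'' a x)).symm
    let l : ∀ v : V, X.Vec v →ₗ[k] E.Vec v := fun v =>
      g v - (LinearMap.ker (vertexMap e v)).subtype ∘ₗ h'' v
    have hl : ∀ {a b : V} (p : a ⟶ b), E.arrowMap p ∘ₗ l a = l b ∘ₗ X.arrowMap p := by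
      intro a b p
      ext x
      have := key p x
      simp only [l, LinearMap.comp_apply, LinearMap.sub_apply, map_sub, Submodule.subtype_apply]
      rw [sub_eq_sub_iff_add_eq_add] at this ⊢
      rw [← this, add_comm]
    refine ⟨homMk l hl, hom_ext_vertexMap fun v => LinearMap.ext fun x => ?_⟩
    rw [vertexMap_comp, vertexMap_homMk, LinearMap.comp_apply, LinearMap.sub_apply, map_sub]
    refine (congrArg₂ (· - ·) (hr' v _) (LinearMap.mem_ker.1 (h'' v x).2)).trans ?_
    exact sub_zero _

/-- Subrepresentations of projective representations are projective. -/
lemma projective_of_mono {K P : FinRep k V} [Projective P] (i : K ⟶ P) [Mono i] :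
    Projective K := by
  refine projective_of_cochainDifferential_surjective K fun Y c => ?_
  choose r hr using fun v => LinearMap.exists_leftInverse_of_injective (vertexMap i v)
    (LinearMap.ker_eq_bot.2 (vertexMap_injective i v))
  obtain ⟨h, hh⟩ := cochainDifferential_surjective_of_projective P Y fun p => c p ∘ₗ r p.1
  refine ⟨fun v => h v ∘ₗ vertexMap i v, ?_⟩
  funext ⟨a, b, p⟩
  ext x
  have h1 := LinearMap.congr_fun (congrFun hh ⟨a, b, p⟩) (vertexMap i a x)
  rw [cochainDifferential_apply] at h1
  rw [cochainDifferential_apply, LinearMap.comp_apply, LinearMap.comp_apply, vertexMap_arrowMap, h1,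
    LinearMap.comp_apply]
  exact congrArg _ (LinearMap.congr_fun (hr a) x)

end Cochains

section Projectives

instance (A : FGModuleCat.{u} k) : Projective A where
  factors {E Z} f e _ := by
    have h2 : Epi ((forget₂ (FGModuleCat k) (ModuleCat k)).map e) := inferInstance
    have h3 : Function.Surjective e.hom.hom := (ModuleCat.epi_iff_surjective _).1 h2
    obtain ⟨r, hr⟩ := LinearMap.exists_rightInverse_of_surjective e.hom.hom
      (LinearMap.range_eq_top.2 h3)
    refine ⟨ObjectProperty.homMk (ModuleCat.ofHom (r ∘ₗ f.hom.hom)), ?_⟩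
    apply FGModuleCat.hom_ext
    change e.hom.hom ∘ₗ r ∘ₗ f.hom.hom = f.hom.hom
    rw [← LinearMap.comp_assoc, hr, LinearMap.id_comp]

variable [Finite V] [hpath : ∀ a b : V, Finite (Quiver.Path a b)]

/-- A representation `N` is a quotient of the coproduct over the vertices `v` of the projective
representations freely generated by `N_v` at `v`. -/
lemma hasTwoTermProjectiveResolutions : HasTwoTermProjectiveResolutions (FinRep k V) := by
  intro N
  have (a b : Paths V) : Finite (a ⟶ b) := hpath a b
  have (a b : Paths V) : HasCoproductsOfShape (a ⟶ b) (FGModuleCat.{u} k) :=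
    inferInstance
  have hev (v : Paths V) :
      ((evaluation (Paths V) (FGModuleCat.{u} k)).obj v).PreservesEpimorphisms :=
    ⟨fun f _ => (NatTrans.epi_iff_epi_app f).1 inferInstance v⟩
  let adj (v : Paths V) := evaluationAdjunctionRight (FGModuleCat.{u} k) v
  have : Finite (Paths V) := ‹Finite V›
  let F (v : Paths V) : FinRep k V :=
    (evaluationLeftAdjoint (FGModuleCat.{u} k) v).obj (N.obj v)
  have hF (v : Paths V) : Projective (F v) := (adj v).map_projective _ inferInstance
  let π : ∐ F ⟶ N := Limits.Sigma.desc fun v => (adj v).counit.app N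
  have : Epi π := by
    rw [NatTrans.epi_iff_epi_app]
    intro v
    have h1 : (adj v).unit.app (N.obj v) ≫ (Limits.Sigma.ι F v).app v ≫ π.app v = 𝟙 _ := by
      rw [← NatTrans.comp_app, Limits.Sigma.ι_desc]
      exact (adj v).right_triangle_components N
    rw [← Category.assoc] at h1
    have : IsSplitEpi (π.app v) := ⟨⟨_, h1⟩⟩
    infer_instance
  have : Projective (∐ F) :=
    ⟨fun f e he => ⟨Limits.Sigma.desc fun v => Projective.factorThru (Limits.Sigma.ι F v ≫ f) e, by
      ext v : 1
      simp⟩⟩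
  exact ⟨∐ F, π, inferInstance, inferInstance, projective_of_mono (kernel.ι π)⟩

end Projectives

section Euler

variable [Fintype V] [∀ a b : V, Fintype (a ⟶ b)]

/-- The Euler form of two representations, which depends only on their dimension vectors. -/
noncomputable def eulerForm (X Y : FinRep k V) : ℤ :=
  ∑ v : V, (Module.finrank k (X.Vec v) : ℤ) * Module.finrank k (Y.Vec v) -
    ∑ p : (Σ (a : V) (b : V), (a ⟶ b)),
      (Module.finrank k (X.Vec p.1) : ℤ) * Module.finrank k (Y.Vec p.2.1)

lemma finrank_cochain (X Y : FinRep k V) :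
    (Module.finrank k (VertexCochain X Y) : ℤ) - Module.finrank k (ArrowCochain X Y) =
      eulerForm X Y := by
  rw [Module.finrank_pi_fintype, Module.finrank_pi_fintype, eulerForm]
  simp only [Module.finrank_linearMap]
  push_cast
  rfl

instance (X Y : FinRep k V) : Module.Finite k (X ⟶ Y) :=
  Module.Finite.equiv (homEquivKer X Y).symm

lemma eulerForm_le_finrank_hom (X Y : FinRep k V) :
    eulerForm X Y ≤ Module.finrank k (X ⟶ Y) := by
  have h := LinearMap.finrank_range_add_finrank_ker (cochainDifferential X Y)
  have h2 := Submodule.finrank_le (LinearMap.range (cochainDifferential X Y))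
  rw [← finrank_cochain, (homEquivKer X Y).finrank_eq]
  omega

lemma finrank_hom_of_projective (X Y : FinRep k V) [Projective X] :
    (Module.finrank k (X ⟶ Y) : ℤ) = eulerForm X Y := by
  have h := LinearMap.finrank_range_add_finrank_ker (cochainDifferential X Y)
  rw [LinearMap.range_eq_top.2 (cochainDifferential_surjective_of_projective X Y),
    finrank_top] at h
  rw [← finrank_cochain, (homEquivKer X Y).finrank_eq]
  omega

/-- The Euler form computes `dim Hom - dim Ext¹`. -/
lemma extDim_eq [∀ a b : V, Finite (Quiver.Path a b)] [HasDerivedCategory.{w} (FinRep k V)]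
    (X Y : FinRep k V) :
    (DerivedCategory.extDim k X Y : ℤ) = Module.finrank k (X ⟶ Y) - eulerForm X Y := by
  obtain ⟨P, π, _, _, _⟩ := hasTwoTermProjectiveResolutions X
  have h1 := DerivedCategory.extDim_add (k := k) π Y
  have h2 : eulerForm P Y = eulerForm (kernel π) Y + eulerForm X Y := by
    simp only [eulerForm, ← finrank_kernel_add π]
    push_cast
    simp only [add_mul, Finset.sum_add_distrib]
    ring
  have h3 := finrank_hom_of_projective P Y
  have h4 := finrank_hom_of_projective (kernel π) Y
  omega

end Euler

end FinRep

/-! ### The quiver of type A -/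

instance : DecidableEq ArrowDir
  | .right, .right => isTrue rfl
  | .left, .left => isTrue rfl
  | .right, .left => isFalse nofun
  | .left, .right => isFalse nofun

namespace TypeAVertex

variable {n : ℕ} {α : ℕ → ArrowDir}

lemma ext {a b : TypeAVertex n α} (h : a.val = b.val) : a = b := by
  cases a; cases b; cases h; rfl

/-- The vertices are the elements of `{1, …, n}`. -/
def equivIcc : TypeAVertex n α ≃ {s : ℕ // s ∈ Finset.Icc 1 n} where
  toFun a := ⟨a.val, Finset.mem_Icc.2 ⟨a.one_le, a.le⟩⟩
  invFun s := ⟨s.1, (Finset.mem_Icc.1 s.2).1, (Finset.mem_Icc.1 s.2).2⟩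
  left_inv _ := rfl
  right_inv _ := rfl

instance : Fintype (TypeAVertex n α) := Fintype.ofEquiv _ equivIcc.symm

instance (a b : TypeAVertex n α) : Subsingleton (a ⟶ b) where
  allEq := by
    rintro ⟨s, hs⟩ ⟨t, ht⟩
    apply Subtype.ext
    change s = t
    omega

noncomputable instance (a b : TypeAVertex n α) : Fintype (a ⟶ b) := Fintype.ofFinite _

lemma sum_vertex (F : ℕ → ℤ) : ∑ v : TypeAVertex n α, F v.val = ∑ s ∈ Finset.Icc 1 n, F s := by
  rw [← Finset.sum_coe_sort (Finset.Icc 1 n) F]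
  exact Fintype.sum_equiv equivIcc _ _ fun _ => rfl

/-- The arrow at the edge `s`. -/
def arrow (α : ℕ → ArrowDir) (s : {s : ℕ // s ∈ Finset.Ico 1 n}) :
    Σ (a : TypeAVertex n α) (b : TypeAVertex n α), (a ⟶ b) :=
  have h := Finset.mem_Ico.1 s.2
  match hα : α s.1 with
  | .right => ⟨⟨s.1, h.1, h.2.le⟩, ⟨s.1 + 1, by omega, h.2⟩, ⟨s.1, Or.inl ⟨hα, rfl, rfl⟩⟩⟩
  | .left => ⟨⟨s.1 + 1, by omega, h.2⟩, ⟨s.1, h.1, h.2.le⟩, ⟨s.1, Or.inr ⟨hα, rfl, rfl⟩⟩⟩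

lemma arrow_val (α : ℕ → ArrowDir) (s : {s : ℕ // s ∈ Finset.Ico 1 n}) :
    (arrow α s).2.2.1 = s.1 := by
  unfold arrow
  split <;> rfl

lemma arrow_ends (α : ℕ → ArrowDir) (s : {s : ℕ // s ∈ Finset.Ico 1 n}) :
    (α s.1 = .right ∧ (arrow α s).1.val = s.1 ∧ (arrow α s).2.1.val = s.1 + 1) ∨
      (α s.1 = .left ∧ (arrow α s).1.val = s.1 + 1 ∧ (arrow α s).2.1.val = s.1) := by
  have h := (arrow α s).2.2.2
  rwa [arrow_val] at h

lemma edge_mem {a b : TypeAVertex n α} (p : a ⟶ b) : p.1 ∈ Finset.Ico 1 n := by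
  have := p.2
  have := a.one_le
  have := b.one_le
  have := a.le
  have := b.le
  rw [Finset.mem_Ico]
  omega

/-- The arrows are indexed by the edges `1, …, n - 1`. -/
noncomputable def arrowEquiv : (Σ (a : TypeAVertex n α) (b : TypeAVertex n α), (a ⟶ b)) ≃
    {s : ℕ // s ∈ Finset.Ico 1 n} where
  toFun p := ⟨p.2.2.1, edge_mem p.2.2⟩
  invFun s := arrow α s
  left_inv := by
    rintro ⟨a, b, p⟩
    have h1 := arrow_ends α ⟨p.1, edge_mem p⟩
    have h2 := p.2
    change arrow α ⟨p.1, edge_mem p⟩ = _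
    generalize arrow α ⟨p.1, edge_mem p⟩ = q at h1 ⊢
    obtain ⟨a', b', q⟩ := q
    have hne : ¬ (α p.1 = .right ∧ α p.1 = .left) := by
      rintro ⟨h, h'⟩
      rw [h] at h'
      cases h'
    have ha : a' = a := ext (by dsimp only at h1; grind)
    have hb : b' = b := ext (by dsimp only at h1; grind)
    subst ha hb
    rw [Subsingleton.elim q p]
  right_inv s := Subtype.ext (arrow_val α s)

lemma sum_arrow (F : ℕ → ℕ → ℤ) :
    ∑ p : (Σ (a : TypeAVertex n α) (b : TypeAVertex n α), (a ⟶ b)), F p.1.val p.2.1.val =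
      ∑ s ∈ Finset.Ico 1 n, if α s = .right then F s (s + 1) else F (s + 1) s := by
  rw [← Finset.sum_coe_sort (Finset.Ico 1 n)]
  refine Fintype.sum_equiv arrowEquiv _ _ ?_
  rintro ⟨a, b, p⟩
  change F a.val b.val = if α p.1 = .right then F p.1 (p.1 + 1) else F (p.1 + 1) p.1
  rcases p.2 with ⟨h, h1, h2⟩ | ⟨h, h1, h2⟩
  · rw [if_pos h]
    exact congrArg₂ F h1 h2
  · rw [if_neg (by rw [h]; simp)]
    exact congrArg₂ F h1 h2

/-- A path does not change its direction. -/
lemma path_cases {a b : TypeAVertex n α} (p : Quiver.Path a b) : a.val = b.val ∨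
    (a.val < b.val ∧ ∀ s, a.val ≤ s → s < b.val → α s = .right) ∨
    (b.val < a.val ∧ ∀ s, b.val ≤ s → s < a.val → α s = .left) := by
  induction p with
  | nil => exact Or.inl rfl
  | @cons b c p e ih =>
    rcases e.2 with ⟨h, h1, h2⟩ | ⟨h, h1, h2⟩
    · refine Or.inr (Or.inl ?_)
      rcases ih with ih | ⟨ih, ih'⟩ | ⟨ih, ih'⟩
      · refine ⟨by omega, fun s hs hs' => ?_⟩
        obtain rfl : s = e.1 := by omega
        exact h
      · refine ⟨by omega, fun s hs hs' => ?_⟩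
        rcases Nat.lt_or_ge s b.val with hlt | hge
        · exact ih' s hs hlt
        · obtain rfl : s = e.1 := by omega
          exact h
      · have := ih' e.1 (by omega) (by omega)
        rw [h] at this
        cases this
    · refine Or.inr (Or.inr ?_)
      rcases ih with ih | ⟨ih, ih'⟩ | ⟨ih, ih'⟩
      · refine ⟨by omega, fun s hs hs' => ?_⟩
        obtain rfl : s = e.1 := by omega
        exact h
      · have := ih' e.1 (by omega) (by omega)
        rw [h] at this
        cases this
      · refine ⟨by omega, fun s hs hs' => ?_⟩
        rcases Nat.lt_or_ge s b.val with hlt | hge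
        · obtain rfl : s = e.1 := by omega
          exact h
        · exact ih' s hge hs'

lemma not_path_of_arrow {a b : TypeAVertex n α} (p : Quiver.Path a b) (e : b ⟶ a) : False := by
  have h := e.2
  rcases path_cases p with h1 | ⟨h1, h2⟩ | ⟨h1, h2⟩
  · omega
  · have := h2 e.1 (by omega) (by omega)
    rcases h with ⟨h, _⟩ | ⟨h, h3, h4⟩
    · omega
    · rw [h] at this; cases this
  · have := h2 e.1 (by omega) (by omega)
    rcases h with ⟨h, h3, h4⟩ | ⟨h, h3, h4⟩
    · rw [h] at this; cases this
    · omega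

instance (a b : TypeAVertex n α) : Subsingleton (Quiver.Path a b) where
  allEq p := by
    induction p with
    | nil =>
      intro q
      cases q with
      | nil => rfl
      | cons q e => exact (not_path_of_arrow q e).elim
    | @cons b c p e ih =>
      intro q
      cases q with
      | nil => exact (not_path_of_arrow p e).elim
      | @cons b' _ q e' =>
        have hb : b = b' := by
          apply ext
          by_contra hne
          have hlr : ∀ {s : ℕ}, α s = .right → α s = .left → False := by
            intro s h h'
            rw [h] at h'
            cases h'
          have key : ∀ {b b' : TypeAVertex n α} (_ : Quiver.Path a b) (_ : Quiver.Path a b')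
              (e : b ⟶ c) (e' : b' ⟶ c) (_ : α e.1 = .right ∧ b.val = e.1 ∧ c.val = e.1 + 1)
              (_ : α e'.1 = .left ∧ b'.val = e'.1 + 1 ∧ c.val = e'.1), False := by
            intro b b' p q e e' ⟨h, h1, h2⟩ ⟨h', h1', h2'⟩
            rcases Nat.lt_or_ge a.val c.val with hac | hac
            · rcases path_cases q with hq | ⟨hq, hq'⟩ | ⟨hq, hq'⟩
              · omega
              · exact hlr (hq' e'.1 (by omega) (by omega)) h'
              · omega
            · rcases path_cases p with hp | ⟨hp, hp'⟩ | ⟨hp, hp'⟩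
              · omega
              · omega
              · exact hlr h (hp' e.1 (by omega) (by omega))
          rcases e.2 with h | h <;> rcases e'.2 with h' | h'
          · omega
          · exact key p q e e' h h'
          · exact key q p e' e h' h
          · omega
        subst hb
        rw [ih q, Subsingleton.elim e e']

end TypeAVertex

/-! ### The combinatorics of intervals -/

namespace TypeAInterval

variable (n : ℕ) (α : ℕ → ArrowDir)

/-- The position of the left end `s` of an interval: among intervals through a given vertex, there
is a nonzero morphism from one with left end `s` to one with left end `s'`, as far as the left ends
are concerned, if and only if `leftKey α s ≤ leftKey α s'`. -/
def leftKey (s : ℕ) : ℤ := if α (s - 1) = .right then -s else s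

/-- The position of the right end `t` of an interval, the mirror image of `leftKey`. -/
def rightKey (t : ℕ) : ℤ := if α t = .right then n + 1 - t else t - (n + 1)

variable {n α}

lemma leftKey_injective {s s' : ℕ} (hs : 1 ≤ s) (hs' : 1 ≤ s') (h : leftKey α s = leftKey α s') :
    s = s' := by
  unfold leftKey at h
  split_ifs at h <;> omega

lemma rightKey_injective {t t' : ℕ} (ht : t ≤ n) (ht' : t' ≤ n)
    (h : rightKey n α t = rightKey n α t') : t = t' := by
  unfold rightKey at h
  split_ifs at h <;> omega

/-- The contribution of the edge `u` to the Euler form of the intervals `[s, t]` and `[s', t']`. -/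
def edgeTerm (α : ℕ → ArrowDir) (s t s' t' u : ℕ) : ℤ :=
  if α u = .right then (if (s ≤ u ∧ u ≤ t) ∧ (s' ≤ u + 1 ∧ u + 1 ≤ t') then 1 else 0)
  else (if (s ≤ u + 1 ∧ u + 1 ≤ t) ∧ (s' ≤ u ∧ u ≤ t') then 1 else 0)

/-- The edges inside `[s, t] ∩ [s', t']` contribute to the Euler form, and so do the edges at the
ends of the intersection where the keys obstruct a morphism. -/
lemma edgeTerm_eq {s t s' t' u : ℕ} (hs : 1 ≤ s) (hs' : 1 ≤ s') (ht : t ≤ n) (ht' : t' ≤ n)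
    (hC : max s s' ≤ min t t') : edgeTerm α s t s' t' u =
      (if max s s' ≤ u ∧ u < min t t' then 1 else 0) +
      (if u = max s s' - 1 then (if leftKey α s' < leftKey α s then 1 else 0) else 0) +
      (if u = min t t' then (if rightKey n α t' < rightKey n α t then 1 else 0) else 0) := by
  unfold edgeTerm
  have hL : u = max s s' - 1 → ((leftKey α s' < leftKey α s) ↔
      (s < s' ∧ α u = .right) ∨ (s' < s ∧ ¬ α u = .right)) := by
    rintro rfl
    unfold leftKey
    rcases lt_trichotomy s s' with h | rfl | h
    · rw [max_eq_right h.le]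
      split_ifs <;> simp [*] <;> omega
    · simp
    · rw [max_eq_left h.le]
      split_ifs <;> simp [*] <;> omega
  have hR : u = min t t' → ((rightKey n α t' < rightKey n α t) ↔
      (t' < t ∧ ¬ α u = .right) ∨ (t < t' ∧ α u = .right)) := by
    rintro rfl
    unfold rightKey
    rcases lt_trichotomy t t' with h | rfl | h
    · rw [min_eq_left h.le]
      split_ifs <;> simp [*] <;> omega
    · simp
    · rw [min_eq_right h.le]
      split_ifs <;> simp [*] <;> omega
  by_cases h1 : u = max s s' - 1
  · have h2 : u ≠ min t t' := by omega
    rw [if_pos h1, if_neg h2]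
    simp only [hL h1]
    clear hL hR
    by_cases hu : α u = .right
    · simp only [eq_true hu, not_true_eq_false, and_true, and_false, or_false, if_true]
      split_ifs <;> omega
    · simp only [eq_false hu, not_false_eq_true, and_true, and_false, false_or, if_false]
      split_ifs <;> omega
  · rw [if_neg h1]
    by_cases h2 : u = min t t'
    · rw [if_pos h2]
      simp only [hR h2]
      clear hL hR
      by_cases hu : α u = .right
      · simp only [eq_true hu, not_true_eq_false, and_true, and_false, false_or, if_true]
        split_ifs <;> omega
      · simp only [eq_false hu, not_false_eq_true, and_true, and_false, or_false, if_false]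
        split_ifs <;> omega
    · rw [if_neg h2]
      clear hL hR
      split_ifs <;> omega

lemma sum_interval_sub_sum_edgeTerm {s t s' t' : ℕ} (hs : 1 ≤ s) (hs' : 1 ≤ s') (ht : t ≤ n)
    (ht' : t' ≤ n) (hC : max s s' ≤ min t t') :
    (∑ v ∈ Finset.Icc 1 n, if (s ≤ v ∧ v ≤ t) ∧ (s' ≤ v ∧ v ≤ t') then (1 : ℤ) else 0) -
      ∑ u ∈ Finset.Ico 1 n, edgeTerm α s t s' t' u =
    1 - (if leftKey α s' < leftKey α s then 1 else 0) -
      (if rightKey n α t' < rightKey n α t then 1 else 0) := by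
  have h1 : (∑ v ∈ Finset.Icc 1 n, if (s ≤ v ∧ v ≤ t) ∧ (s' ≤ v ∧ v ≤ t') then (1 : ℤ) else 0) =
      min t t' + 1 - max s s' := by
    rw [← Finset.sum_filter]
    have : (Finset.Icc 1 n).filter (fun v => (s ≤ v ∧ v ≤ t) ∧ (s' ≤ v ∧ v ≤ t')) =
        Finset.Icc (max s s') (min t t') := by
      ext v
      simp only [Finset.mem_filter, Finset.mem_Icc]
      omega
    rw [this, Finset.sum_const, Nat.card_Icc, nsmul_eq_mul]
    omega
  simp only [edgeTerm_eq hs hs' ht ht' hC, Finset.sum_add_distrib]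
  have h2 : (∑ u ∈ Finset.Ico 1 n,
      if max s s' ≤ u ∧ u < min t t' then (1 : ℤ) else 0) = min t t' - max s s' := by
    rw [← Finset.sum_filter]
    have : (Finset.Ico 1 n).filter (fun u => max s s' ≤ u ∧ u < min t t') =
        Finset.Ico (max s s') (min t t') := by
      ext v
      simp only [Finset.mem_filter, Finset.mem_Ico]
      omega
    rw [this, Finset.sum_const, Nat.card_Ico, nsmul_eq_mul]
    omega
  rw [h1, h2, Finset.sum_ite_eq', Finset.sum_ite_eq']
  have h3 : max s s' - 1 ∉ Finset.Ico 1 n → s = s' := by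
    rw [Finset.mem_Ico]
    omega
  have h4 : min t t' ∉ Finset.Ico 1 n → t = t' := by
    rw [Finset.mem_Ico]
    omega
  have h5 : (if max s s' - 1 ∈ Finset.Ico 1 n then
      (if leftKey α s' < leftKey α s then (1 : ℤ) else 0) else 0) =
        if leftKey α s' < leftKey α s then 1 else 0 := by
    split_ifs with h6 h7 h7
    · rfl
    · rfl
    · rw [h3 h6] at h7
      exact absurd h7 (lt_irrefl _)
    · rfl
  have h6 : (if min t t' ∈ Finset.Ico 1 n then
      (if rightKey n α t' < rightKey n α t then (1 : ℤ) else 0) else 0) =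
        if rightKey n α t' < rightKey n α t then 1 else 0 := by
    split_ifs with h6 h7 h7
    · rfl
    · rfl
    · rw [h4 h6] at h7
      exact absurd h7 (lt_irrefl _)
    · rfl
  rw [h5, h6]
  ring

/-- If two disjoint intervals have a nonzero Euler form, then there is an arrow from the first to
the second. -/
lemma adjacent_of_sum_edgeTerm_ne_zero {s t s' t' : ℕ} (hC : min t t' < max s s')
    (h : ∑ u ∈ Finset.Ico 1 n, edgeTerm α s t s' t' u ≠ 0) :
    s ≤ t ∧ s' ≤ t' ∧ ((t + 1 = s' ∧ α t = .right) ∨ (t' + 1 = s ∧ α t' = .left)) := by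
  obtain ⟨u, _, hu⟩ := Finset.exists_ne_zero_of_sum_ne_zero h
  unfold edgeTerm at hu
  split_ifs at hu with h1 h2 h2
  · obtain rfl : u = t := by omega
    exact ⟨by omega, by omega, Or.inl ⟨by omega, h1⟩⟩
  · exact absurd rfl hu
  · obtain rfl : u = t' := by omega
    refine ⟨by omega, by omega, Or.inr ⟨by omega, ?_⟩⟩
    cases hα : α u
    · exact absurd hα h1
    · rfl
  · exact absurd rfl hu

/-- A nonnegative integer vector on which the quadratic form of type `Aₙ` takes a value at most `1`
is the indicator function of an interval, or zero. -/
lemma exists_interval_of_sum_sq_le (x : ℕ → ℕ) (h0 : x 0 = 0) (hn : x (n + 1) = 0)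
    (hx : ∃ v ≤ n, x v ≠ 0)
    (hq : ∑ u ∈ Finset.range (n + 1), ((x u : ℤ) - x (u + 1)) ^ 2 ≤ 2) :
    ∃ s t, 1 ≤ s ∧ s ≤ t ∧ t ≤ n ∧ ∀ v ≤ n, x v = if s ≤ v ∧ v ≤ t then 1 else 0 := by
  classical
  -- `s` is the first index in the support, and `t + 1` is the first index after `s` outside of it.
  obtain ⟨v₀, hv₀, hv₀'⟩ := hx
  let s := Nat.find (p := fun v => x v ≠ 0) ⟨v₀, hv₀'⟩
  have hs : x s ≠ 0 := Nat.find_spec (p := fun v => x v ≠ 0) ⟨v₀, hv₀'⟩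
  have hsmin : ∀ v < s, x v = 0 := fun v hv =>
    not_not.1 (Nat.find_min (p := fun v => x v ≠ 0) ⟨v₀, hv₀'⟩ hv)
  have hsv : s ≤ v₀ := Nat.find_min' _ hv₀'
  have hs1 : 1 ≤ s := by
    by_contra h
    have : s = 0 := by omega
    rw [this] at hs
    exact hs h0
  have hex : ∃ t, s ≤ t ∧ x (t + 1) = 0 := ⟨n, hsv.trans hv₀, hn⟩
  let t := Nat.find hex
  have ht : s ≤ t ∧ x (t + 1) = 0 := Nat.find_spec hex
  have htn : t ≤ n := Nat.find_min' hex ⟨hsv.trans hv₀, hn⟩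
  have htmin : ∀ v, s ≤ v → v ≤ t → x v ≠ 0 := by
    intro v hsv hvt hv
    rcases Nat.eq_or_lt_of_le hsv with rfl | hlt
    · exact hs hv
    · exact Nat.find_min hex (m := v - 1) (by omega)
        ⟨by omega, by rwa [Nat.sub_add_cancel (by omega)]⟩
  let D : ℕ → ℤ := fun u => ((x u : ℤ) - x (u + 1)) ^ 2
  have hD0 : ∀ u, 0 ≤ D u := fun u => sq_nonneg _
  have hDs : D (s - 1) = (x s : ℤ) ^ 2 := by
    simp only [D]
    rw [Nat.sub_add_cancel hs1, hsmin (s - 1) (by omega)]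
    push_cast
    ring
  have hDt : D t = (x t : ℤ) ^ 2 := by
    simp only [D]
    rw [ht.2]
    push_cast
    ring
  have hxs : (1 : ℤ) ≤ x s := by
    have := Nat.pos_of_ne_zero hs
    exact_mod_cast this
  have hxt : (1 : ℤ) ≤ x t := by
    have := Nat.pos_of_ne_zero (htmin t ht.1 le_rfl)
    exact_mod_cast this
  have hne : s - 1 ≠ t := by omega
  have hsum2 : D (s - 1) + D t ≤ 2 := by
    refine le_trans ?_ hq
    rw [← Finset.sum_pair hne (f := D)]
    refine Finset.sum_le_sum_of_subset_of_nonneg ?_ fun u _ _ => hD0 u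
    intro u hu
    simp only [Finset.mem_insert, Finset.mem_singleton] at hu
    rw [Finset.mem_range]
    omega
  have hother : ∀ u ≤ n, u ≠ s - 1 → u ≠ t → x u = x (u + 1) := by
    intro u hu h1 h2
    have hsum3 : D u + (D (s - 1) + D t) ≤ 2 := by
      refine le_trans ?_ hq
      rw [← Finset.sum_pair hne (f := D), ← Finset.sum_insert (by simp [h1, h2])]
      refine Finset.sum_le_sum_of_subset_of_nonneg ?_ fun u _ _ => hD0 u
      intro v hv
      simp only [Finset.mem_insert, Finset.mem_singleton] at hv
      rw [Finset.mem_range]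
      omega
    have : D u ≤ 0 := by nlinarith
    have h3 : (x u : ℤ) - x (u + 1) = 0 := by
      simp only [D] at this
      exact pow_eq_zero_iff (two_ne_zero) |>.1 (le_antisymm this (sq_nonneg _))
    have h4 : (x u : ℤ) = x (u + 1) := sub_eq_zero.1 h3
    exact_mod_cast h4
  have hxs1 : x s = 1 := by
    have : (x s : ℤ) ≤ 1 := by nlinarith
    omega
  refine ⟨s, t, hs1, ht.1, htn, fun v => ?_⟩
  induction v with
  | zero =>
    intro _
    rw [if_neg (by omega), h0]
  | succ v ih =>
    intro hv
    have ih := ih (by omega)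
    by_cases h1 : v = s - 1
    · have : v + 1 = s := by omega
      rw [this, if_pos ⟨le_rfl, ht.1⟩, hxs1]
    by_cases h2 : v = t
    · rw [if_neg (by omega), h2]
      exact ht.2
    rw [← hother v (by omega) h1 h2, ih]
    split_ifs <;> omega

/-- Summation by parts for the quadratic form of type `Aₙ`. -/
lemma sum_sq_sub_eq (x : ℕ → ℤ) (h0 : x 0 = 0) (hn : x (n + 1) = 0) :
    ∑ u ∈ Finset.range (n + 1), (x u - x (u + 1)) ^ 2 =
      2 * (∑ v ∈ Finset.Icc 1 n, x v * x v - ∑ u ∈ Finset.Ico 1 n, x u * x (u + 1)) := by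
  have h1 : ∀ m : ℕ, ∑ u ∈ Finset.range (m + 1), (x u - x (u + 1)) ^ 2 =
      2 * (∑ v ∈ Finset.Icc 1 m, x v * x v - ∑ u ∈ Finset.Ico 1 m, x u * x (u + 1)) +
        x (m + 1) ^ 2 - (if m = 0 then 0 else 2 * (x m * x (m + 1))) := by
    intro m
    induction m with
    | zero => simp [h0]
    | succ m ih =>
      rw [Finset.sum_range_succ, ih, Finset.sum_Icc_succ_top (by omega)]
      rcases Nat.eq_zero_or_pos m with rfl | hm
      · simp
        ring
      · rw [Finset.sum_Ico_succ_top hm, if_neg (by omega), if_neg (by omega)]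
        ring
  rw [h1, hn]
  simp

end TypeAInterval

/-! ### Morphisms and extensions between interval representations -/

namespace FinRep

open TypeAInterval

variable {k : Type u} [Field k] {n : ℕ} {α : ℕ → ArrowDir}

/-- `N` is isomorphic to the interval module `M{s,t}`: it has dimension one at the vertices of
`[s, t]` and vanishes elsewhere, and the arrows inside `[s, t]` act bijectively. Here `t < s` is
allowed, and means that `N` is zero. -/
structure IsInterval (N : FinRep k (TypeAVertex n α)) (s t : ℕ) : Prop where
  finrank_vec : ∀ v : TypeAVertex n α,
    Module.finrank k (N.Vec v) = if s ≤ v.val ∧ v.val ≤ t then 1 else 0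
  bijective : ∀ {a b : TypeAVertex n α} (p : a ⟶ b), s ≤ a.val → a.val ≤ t → s ≤ b.val →
    b.val ≤ t → Function.Bijective (N.arrowMap p)

lemma eulerForm_eq_sum_edge (X Y : FinRep k (TypeAVertex n α)) (x y : ℕ → ℕ)
    (hx : ∀ v : TypeAVertex n α, Module.finrank k (X.Vec v) = x v.val)
    (hy : ∀ v : TypeAVertex n α, Module.finrank k (Y.Vec v) = y v.val) :
    eulerForm X Y = ∑ v ∈ Finset.Icc 1 n, (x v : ℤ) * y v -
      ∑ u ∈ Finset.Ico 1 n, if α u = .right then (x u : ℤ) * y (u + 1) else x (u + 1) * y u := by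
  rw [eulerForm]
  simp only [hx, hy]
  rw [TypeAVertex.sum_vertex fun v => (x v : ℤ) * y v,
    TypeAVertex.sum_arrow fun a b => (x a : ℤ) * y b]

namespace IsInterval

variable {X Y : FinRep k (TypeAVertex n α)} {s t s' t' : ℕ}

lemma eulerForm_eq (hX : IsInterval X s t) (hY : IsInterval Y s' t') :
    eulerForm X Y =
      (∑ v ∈ Finset.Icc 1 n, if (s ≤ v ∧ v ≤ t) ∧ (s' ≤ v ∧ v ≤ t') then (1 : ℤ) else 0) -
        ∑ u ∈ Finset.Ico 1 n, edgeTerm α s t s' t' u := by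
  rw [eulerForm_eq_sum_edge X Y (fun v => if s ≤ v ∧ v ≤ t then 1 else 0)
    (fun v => if s' ≤ v ∧ v ≤ t' then 1 else 0) hX.finrank_vec hY.finrank_vec]
  have hmul (P Q : Prop) [Decidable P] [Decidable Q] :
      (if P then (1 : ℤ) else 0) * (if Q then 1 else 0) = if P ∧ Q then 1 else 0 := by
    split_ifs <;> simp_all
  simp only [Nat.cast_ite, Nat.cast_one, Nat.cast_zero, edgeTerm, hmul]

lemma subsingleton_vec (hX : IsInterval X s t) (v : TypeAVertex n α)
    (hv : ¬ (s ≤ v.val ∧ v.val ≤ t)) : Subsingleton (X.Vec v) := by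
  rw [← Module.finrank_zero_iff (R := k), hX.finrank_vec, if_neg hv]

lemma vertexMap_eq_zero_of_not_mem (hX : IsInterval X s t) (hY : IsInterval Y s' t') (f : X ⟶ Y)
    (v : TypeAVertex n α) (hv : ¬ (max s s' ≤ v.val ∧ v.val ≤ min t t')) : vertexMap f v = 0 := by
  by_cases h : s ≤ v.val ∧ v.val ≤ t
  · have := hY.subsingleton_vec v (by omega)
    exact LinearMap.ext fun x => Subsingleton.elim _ _
  · have := hX.subsingleton_vec v h
    ext x
    rw [Subsingleton.elim x 0, map_zero, map_zero]

/-- An arrow inside `X` which enters the support of `Y` obstructs morphisms. -/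
lemma vertexMap_eq_zero_of_enters (hX : IsInterval X s t) (hY : IsInterval Y s' t') (f : X ⟶ Y)
    {a v : TypeAVertex n α} (p : a ⟶ v) (ha : s ≤ a.val ∧ a.val ≤ t) (hv : s ≤ v.val ∧ v.val ≤ t)
    (ha' : vertexMap f a = 0 ∨ ¬ (s' ≤ a.val ∧ a.val ≤ t')) : vertexMap f v = 0 := by
  have h0 : vertexMap f a = 0 := by
    rcases ha' with h | h
    · exact h
    · exact vertexMap_eq_zero_of_not_mem hX hY f a (by omega)
  ext y
  obtain ⟨x, rfl⟩ := (hX.bijective p ha.1 ha.2 hv.1 hv.2).2 y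
  rw [vertexMap_arrowMap, h0, LinearMap.zero_apply, map_zero, LinearMap.zero_apply]

/-- An arrow inside `Y` which leaves the support of `X` obstructs morphisms. -/
lemma vertexMap_eq_zero_of_leaves (hX : IsInterval X s t) (hY : IsInterval Y s' t') (f : X ⟶ Y)
    {v b : TypeAVertex n α} (p : v ⟶ b) (hv : s' ≤ v.val ∧ v.val ≤ t')
    (hb : s' ≤ b.val ∧ b.val ≤ t') (hb' : vertexMap f b = 0 ∨ ¬ (s ≤ b.val ∧ b.val ≤ t)) :
    vertexMap f v = 0 := by
  have h0 : vertexMap f b = 0 := by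
    rcases hb' with h | h
    · exact h
    · exact vertexMap_eq_zero_of_not_mem hX hY f b (by omega)
  ext x
  apply (hY.bijective p hv.1 hv.2 hb.1 hb.2).1
  rw [← vertexMap_arrowMap, h0, LinearMap.zero_apply, LinearMap.zero_apply, map_zero]

lemma vertexMap_eq_zero_iff_succ (hX : IsInterval X s t) (hY : IsInterval Y s' t') (f : X ⟶ Y)
    {c : ℕ} (h1 : 1 ≤ c) (hn : c + 1 ≤ n) (hc : max s s' ≤ c) (hc' : c + 1 ≤ min t t') :
    vertexMap f ⟨c, h1, by omega⟩ = 0 ↔ vertexMap f ⟨c + 1, by omega, hn⟩ = 0 := by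
  have hs : s ≤ c ∧ c ≤ t := by omega
  have hs1 : s ≤ c + 1 ∧ c + 1 ≤ t := by omega
  have hs' : s' ≤ c ∧ c ≤ t' := by omega
  have hs1' : s' ≤ c + 1 ∧ c + 1 ≤ t' := by omega
  cases hα : α c with
  | right =>
    let p : (⟨c, h1, by omega⟩ : TypeAVertex n α) ⟶ ⟨c + 1, by omega, hn⟩ :=
      ⟨c, Or.inl ⟨hα, rfl, rfl⟩⟩
    exact ⟨fun h => vertexMap_eq_zero_of_enters hX hY f p hs hs1 (Or.inl h),
      fun h => vertexMap_eq_zero_of_leaves hX hY f p hs' hs1' (Or.inl h)⟩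
  | left =>
    let p : (⟨c + 1, by omega, hn⟩ : TypeAVertex n α) ⟶ ⟨c, h1, by omega⟩ :=
      ⟨c, Or.inr ⟨hα, rfl, rfl⟩⟩
    exact ⟨fun h => vertexMap_eq_zero_of_leaves hX hY f p hs1' hs' (Or.inl h),
      fun h => vertexMap_eq_zero_of_enters hX hY f p hs1 hs (Or.inl h)⟩

/-- A morphism between intervals vanishes if it vanishes at one vertex of their intersection. -/
lemma hom_eq_zero_of_vertexMap_eq_zero (hX : IsInterval X s t) (hY : IsInterval Y s' t')
    (f : X ⟶ Y) (v : TypeAVertex n α) (hv : max s s' ≤ v.val ∧ v.val ≤ min t t')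
    (h : vertexMap f v = 0) : f = 0 := by
  apply hom_ext_vertexMap
  intro w
  rw [vertexMap_zero]
  by_cases hw : max s s' ≤ w.val ∧ w.val ≤ min t t'
  · obtain ⟨v, hv1, hvn⟩ := v
    obtain ⟨w, hw1, hwn⟩ := w
    have hup : ∀ (c d : ℕ) (hc : 1 ≤ c) (hcd : c ≤ d) (hd : d ≤ n), max s s' ≤ c → d ≤ min t t' →
        (vertexMap f ⟨c, hc, hcd.trans hd⟩ = 0 ↔ vertexMap f ⟨d, hc.trans hcd, hd⟩ = 0) := by
      intro c d hc hcd
      induction d, hcd using Nat.le_induction with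
      | base => intros; rfl
      | succ d hcd ih =>
        intro hd h1 h2
        rw [ih (by omega) h1 (by omega)]
        exact vertexMap_eq_zero_iff_succ hX hY f (hc.trans hcd) hd (h1.trans hcd) h2
    rcases le_total v w with hvw | hvw
    · exact (hup v w hv1 hvw hwn hv.1 hw.2).1 h
    · exact (hup w v hw1 hvw hvn hw.1 hv.2).2 h
  · exact vertexMap_eq_zero_of_not_mem hX hY f w hw

lemma finrank_hom_le_one (hX : IsInterval X s t) (hY : IsInterval Y s' t') (hs : 1 ≤ s)
    (ht : t ≤ n) (hC : max s s' ≤ min t t') : Module.finrank k (X ⟶ Y) ≤ 1 := by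
  let v : TypeAVertex n α := ⟨max s s', by omega, by omega⟩
  let φ : (X ⟶ Y) →ₗ[k] (X.Vec v →ₗ[k] Y.Vec v) :=
    { toFun := fun f => vertexMap f v
      map_add' := fun _ _ => rfl
      map_smul' := fun _ _ => rfl }
  have hφ : Function.Injective φ := by
    rw [injective_iff_map_eq_zero]
    exact fun f hf => hom_eq_zero_of_vertexMap_eq_zero hX hY f v ⟨le_rfl, hC⟩ hf
  refine (LinearMap.finrank_le_finrank_of_injective hφ).trans ?_
  rw [Module.finrank_linearMap, hX.finrank_vec, hY.finrank_vec]
  split_ifs <;> simp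

lemma hom_eq_zero_of_leftKey_lt (hX : IsInterval X s t) (hY : IsInterval Y s' t') (hs : 1 ≤ s)
    (hs' : 1 ≤ s') (ht : t ≤ n) (hC : max s s' ≤ min t t') (h : leftKey α s' < leftKey α s)
    (f : X ⟶ Y) : f = 0 := by
  refine hom_eq_zero_of_vertexMap_eq_zero hX hY f ⟨max s s', by omega, by omega⟩ ⟨le_rfl, hC⟩ ?_
  rcases lt_trichotomy s s' with hlt | rfl | hlt
  · have hα : α (s' - 1) = .right := by
      by_contra hα
      unfold leftKey at h
      rw [if_neg hα] at h
      split_ifs at h <;> omega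
    let p : (⟨s' - 1, by omega, by omega⟩ : TypeAVertex n α) ⟶ ⟨max s s', by omega, by omega⟩ :=
      ⟨s' - 1, Or.inl ⟨hα, rfl, show max s s' = s' - 1 + 1 by omega⟩⟩
    exact vertexMap_eq_zero_of_enters hX hY f p (by dsimp only; omega) (by dsimp only; omega)
      (Or.inr (by dsimp only; omega))
  · exact absurd h (lt_irrefl _)
  · have hα : α (s - 1) = .left := by
      by_contra hα
      have hα : α (s - 1) = .right := by
        cases hα' : α (s - 1)
        · rfl
        · exact absurd hα' hα
      unfold leftKey at h
      rw [if_pos hα] at h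
      split_ifs at h <;> omega
    let p : (⟨max s s', by omega, by omega⟩ : TypeAVertex n α) ⟶ ⟨s - 1, by omega, by omega⟩ :=
      ⟨s - 1, Or.inr ⟨hα, show max s s' = s - 1 + 1 by omega, rfl⟩⟩
    exact vertexMap_eq_zero_of_leaves hX hY f p (by dsimp only; omega) (by dsimp only; omega)
      (Or.inr (by dsimp only; omega))

lemma hom_eq_zero_of_rightKey_lt (hX : IsInterval X s t) (hY : IsInterval Y s' t') (hs : 1 ≤ s)
    (ht : t ≤ n) (ht' : t' ≤ n) (hC : max s s' ≤ min t t')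
    (h : rightKey n α t' < rightKey n α t) (f : X ⟶ Y) : f = 0 := by
  refine hom_eq_zero_of_vertexMap_eq_zero hX hY f ⟨min t t', by omega, by omega⟩ ⟨hC, le_rfl⟩ ?_
  rcases lt_trichotomy t t' with hlt | rfl | hlt
  · have hα : α t = .right := by
      by_contra hα
      unfold rightKey at h
      rw [if_neg hα] at h
      split_ifs at h <;> omega
    let p : (⟨min t t', by omega, by omega⟩ : TypeAVertex n α) ⟶ ⟨t + 1, by omega, by omega⟩ :=
      ⟨t, Or.inl ⟨hα, show min t t' = t by omega, rfl⟩⟩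
    exact vertexMap_eq_zero_of_leaves hX hY f p (by dsimp only; omega) (by dsimp only; omega)
      (Or.inr (by dsimp only; omega))
  · exact absurd h (lt_irrefl _)
  · have hα : α t' = .left := by
      by_contra hα
      have hα : α t' = .right := by
        cases hα' : α t'
        · rfl
        · exact absurd hα' hα
      unfold rightKey at h
      rw [if_pos hα] at h
      split_ifs at h <;> omega
    let p : (⟨t' + 1, by omega, by omega⟩ : TypeAVertex n α) ⟶ ⟨min t t', by omega, by omega⟩ :=
      ⟨t', Or.inr ⟨hα, rfl, show min t t' = t' by omega⟩⟩
    exact vertexMap_eq_zero_of_enters hX hY f p (by dsimp only; omega) (by dsimp only; omega)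
      (Or.inr (by dsimp only; omega))

/-- Nonzero morphisms between intersecting intervals are detected by the keys of their ends. -/
lemma finrank_hom_eq (hX : IsInterval X s t) (hY : IsInterval Y s' t') (hs : 1 ≤ s) (hs' : 1 ≤ s')
    (ht : t ≤ n) (ht' : t' ≤ n) (hC : max s s' ≤ min t t') :
    Module.finrank k (X ⟶ Y) =
      if leftKey α s ≤ leftKey α s' ∧ rightKey n α t ≤ rightKey n α t' then 1 else 0 := by
  split_ifs with h
  · refine le_antisymm (hX.finrank_hom_le_one hY hs ht hC) ?_
    have h1 := eulerForm_le_finrank_hom X Y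
    rw [hX.eulerForm_eq hY, sum_interval_sub_sum_edgeTerm hs hs' ht ht' hC, if_neg (not_lt.2 h.1),
      if_neg (not_lt.2 h.2)] at h1
    omega
  · have : Subsingleton (X ⟶ Y) := subsingleton_of_forall_eq 0 fun f => by
      rcases not_and_or.1 h with h | h
      · exact hX.hom_eq_zero_of_leftKey_lt hY hs hs' ht hC (not_le.1 h) f
      · exact hX.hom_eq_zero_of_rightKey_lt hY hs ht ht' hC (not_le.1 h) f
    exact Module.finrank_zero_of_subsingleton

lemma finrank_hom_of_disjoint (hX : IsInterval X s t) (hY : IsInterval Y s' t')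
    (hC : min t t' < max s s') : Module.finrank k (X ⟶ Y) = 0 := by
  have : Subsingleton (X ⟶ Y) := subsingleton_of_forall_eq 0 fun f =>
    hom_ext_vertexMap fun v => by
      rw [vertexMap_zero]
      exact vertexMap_eq_zero_of_not_mem hX hY f v (by omega)
  exact Module.finrank_zero_of_subsingleton

variable [HasDerivedCategory.{w} (FinRep k (TypeAVertex n α))]

lemma extDim_eq_ite (hX : IsInterval X s t) (hY : IsInterval Y s' t') (hs : 1 ≤ s) (hs' : 1 ≤ s')
    (ht : t ≤ n) (ht' : t' ≤ n) (hC : max s s' ≤ min t t') :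
    DerivedCategory.extDim k X Y =
      if leftKey α s' < leftKey α s ∧ rightKey n α t' < rightKey n α t then 1 else 0 := by
  have h := extDim_eq X Y
  rw [hX.finrank_hom_eq hY hs hs' ht ht' hC, hX.eulerForm_eq hY,
    sum_interval_sub_sum_edgeTerm hs hs' ht ht' hC] at h
  split_ifs at h ⊢ <;> omega

lemma adjacent_of_extDim_ne_zero (hX : IsInterval X s t) (hY : IsInterval Y s' t')
    (hC : min t t' < max s s') (h : DerivedCategory.extDim k X Y ≠ 0) :
    s ≤ t ∧ s' ≤ t' ∧ ((t + 1 = s' ∧ α t = .right) ∨ (t' + 1 = s ∧ α t' = .left)) := by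
  refine adjacent_of_sum_edgeTerm_ne_zero (n := n) hC fun h0 => h ?_
  have h1 := extDim_eq X Y
  rw [hX.finrank_hom_of_disjoint hY hC, hX.eulerForm_eq hY, h0, Finset.sum_eq_zero] at h1
  · simpa using h1
  · intro v _
    rw [if_neg (by omega)]

end IsInterval

end FinRep

/-! ### Bricks and tensor products of interval representations -/

namespace FinRep

open TypeAInterval FrobeniusPerron

variable {k : Type u} [Field k] {n : ℕ} {α : ℕ → ArrowDir}

lemma IsInterval.isBrick {X : FinRep k (TypeAVertex n α)} {s t : ℕ} (hX : IsInterval X s t)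
    (hs : 1 ≤ s) (hst : s ≤ t) (ht : t ≤ n) : IsBrick k X := by
  have h1 : Module.finrank k (X ⟶ X) = 1 := by
    rw [hX.finrank_hom_eq hX hs hs ht ht (by simpa using hst), if_pos ⟨le_rfl, le_rfl⟩]
  have hne : 𝟙 X ≠ 0 := by
    intro h0
    have : Subsingleton (X ⟶ X) := subsingleton_of_forall_eq 0 fun f => by
      rw [← Category.id_comp f, h0, zero_comp]
    rw [Module.finrank_zero_of_subsingleton] at h1
    exact zero_ne_one h1
  let φ : k →ₗ[k] (X ⟶ X) := LinearMap.toSpanSingleton k _ (𝟙 X)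
  have hφ : Function.Injective φ := smul_left_injective k hne
  exact ⟨hφ, (LinearMap.injective_iff_surjective_of_finrank_eq_finrank
    ((Module.finrank_self k).trans h1.symm)).1 hφ⟩

/-- The dimension vector of a brick is the indicator function of an interval, since the Euler form,
a positive definite quadratic form, takes a value at most `dim End = 1` on it. -/
lemma exists_finrank_vec_eq_of_isBrick {N : FinRep k (TypeAVertex n α)} (hN : IsBrick k N) :
    ∃ s t, 1 ≤ s ∧ s ≤ t ∧ t ≤ n ∧ ∀ v : TypeAVertex n α,
      Module.finrank k (N.Vec v) = if s ≤ v.val ∧ v.val ≤ t then 1 else 0 := by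
  have h1 : Module.finrank k (N ⟶ N) = 1 := by
    let φ : k →ₗ[k] (N ⟶ N) := LinearMap.toSpanSingleton k _ (𝟙 N)
    rw [← (LinearEquiv.ofBijective φ hN).finrank_eq, Module.finrank_self]
  let x : ℕ → ℕ := fun v =>
    if h : 1 ≤ v ∧ v ≤ n then Module.finrank k (N.Vec (⟨v, h.1, h.2⟩ : TypeAVertex n α)) else 0
  have hx : ∀ v : TypeAVertex n α, Module.finrank k (N.Vec v) = x v.val := fun v => by
    simp only [x]
    rw [dif_pos ⟨v.one_le, v.le⟩]
  have hx0 : x 0 = 0 := dif_neg (by omega)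
  have hxn : x (n + 1) = 0 := dif_neg (by omega)
  have hne : ∃ v ≤ n, x v ≠ 0 := by
    by_contra! h
    have : Subsingleton (N ⟶ N) := subsingleton_of_forall_eq 0 fun f =>
      hom_ext_vertexMap fun v => by
        have : Subsingleton (N.Vec v) := by
          rw [← Module.finrank_zero_iff (R := k), hx, h v.val v.le]
        exact LinearMap.ext fun y => Subsingleton.elim _ _
    rw [Module.finrank_zero_of_subsingleton] at h1
    exact zero_ne_one h1
  obtain ⟨s, t, hs, hst, ht, h⟩ := exists_interval_of_sum_sq_le x hx0 hxn hne (by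
    rw [sum_sq_sub_eq (fun v => (x v : ℤ)) (by simp [hx0]) (by simp [hxn])]
    have h2 := eulerForm_le_finrank_hom N N
    rw [eulerForm_eq_sum_edge N N x x hx hx, h1] at h2
    have h3 : (∑ u ∈ Finset.Ico 1 n,
        if α u = .right then (x u : ℤ) * x (u + 1) else x (u + 1) * x u) =
          ∑ u ∈ Finset.Ico 1 n, (x u : ℤ) * x (u + 1) :=
      Finset.sum_congr rfl fun u _ => by
        split_ifs
        · rfl
        · exact mul_comm _ _
    rw [h3] at h2
    push_cast at h2
    linarith)
  exact ⟨s, t, hs, hst, ht, fun v => (hx v).trans (h v.val v.le)⟩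

/-- If an arrow at the edge `c` acts as zero, then truncating at the edge is an endomorphism. -/
def truncation (N : FinRep k (TypeAVertex n α)) (c : ℕ)
    (hc : ∀ {a b : TypeAVertex n α} (p : a ⟶ b), p.1 = c → N.arrowMap p = 0) : N ⟶ N :=
  homMk (fun v => if v.val ≤ c then LinearMap.id else 0) (by
    intro a b p
    have h := p.2
    by_cases hp : p.1 = c
    · rw [hc p hp, LinearMap.zero_comp, LinearMap.comp_zero]
    · split_ifs
      · rw [LinearMap.id_comp, LinearMap.comp_id]
      · omega
      · omega
      · rw [LinearMap.zero_comp, LinearMap.comp_zero])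

lemma vertexMap_truncation (N : FinRep k (TypeAVertex n α)) (c : ℕ)
    (hc : ∀ {a b : TypeAVertex n α} (p : a ⟶ b), p.1 = c → N.arrowMap p = 0)
    (v : TypeAVertex n α) :
    vertexMap (truncation N c hc) v = if v.val ≤ c then LinearMap.id else 0 := rfl

lemma exists_isInterval_of_isBrick {N : FinRep k (TypeAVertex n α)} (hN : IsBrick k N) :
    ∃ s t, 1 ≤ s ∧ s ≤ t ∧ t ≤ n ∧ IsInterval N s t := by
  obtain ⟨s, t, hs, hst, ht, h⟩ := exists_finrank_vec_eq_of_isBrick hN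
  refine ⟨s, t, hs, hst, ht, h, fun {a b} p ha ha' hb hb' => ?_⟩
  have hfa : Module.finrank k (N.Vec a) = 1 := by rw [h, if_pos ⟨ha, ha'⟩]
  have hfb : Module.finrank k (N.Vec b) = 1 := by rw [h, if_pos ⟨hb, hb'⟩]
  by_cases h0 : N.arrowMap p = 0
  · -- Truncating at this edge is an idempotent endomorphism of `N` which is neither `0` nor `1`.
    exfalso
    have hc : ∀ {a' b' : TypeAVertex n α} (q : a' ⟶ b'), q.1 = p.1 → N.arrowMap q = 0 := by
      intro a' b' q hq
      have h1 := p.2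
      have h2 := q.2
      rw [hq] at h2
      have hne : ¬ (α p.1 = .right ∧ α p.1 = .left) := by
        rintro ⟨h, h'⟩
        rw [h] at h'
        cases h'
      obtain rfl : a' = a := TypeAVertex.ext (by grind)
      obtain rfl : b' = b := TypeAVertex.ext (by grind)
      rw [Subsingleton.elim q p, h0]
    obtain ⟨c, hc'⟩ := hN.2 (truncation N p.1 hc)
    have hcv : ∀ v : TypeAVertex n α, Module.finrank k (N.Vec v) = 1 →
        c = if v.val ≤ p.1 then 1 else 0 := by
      intro v hv
      have : Nontrivial (N.Vec v) := Module.nontrivial_of_finrank_pos (R := k) (by omega)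
      obtain ⟨y, hy⟩ := exists_ne (0 : N.Vec v)
      have h3 : vertexMap (c • 𝟙 N) v y = vertexMap (truncation N p.1 hc) v y :=
        congrArg (fun f : N ⟶ N => vertexMap f v y) hc'
      rw [vertexMap_truncation, vertexMap_smul, vertexMap_id, LinearMap.smul_apply,
        LinearMap.id_apply] at h3
      split_ifs at h3 ⊢
      · have h4 : (c - 1) • y = 0 := by
          rw [sub_smul, one_smul, h3, LinearMap.id_apply, sub_self]
        exact sub_eq_zero.1 ((smul_eq_zero.1 h4).resolve_right hy)
      · exact (smul_eq_zero.1 h3).resolve_right hy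
    have h1 := hcv a hfa
    have h2 := hcv b hfb
    have h3 := p.2
    split_ifs at h1 h2
    · omega
    · exact one_ne_zero (h1.symm.trans h2)
    · exact one_ne_zero (h2.symm.trans h1)
    · omega
  · have hsurj : Function.Surjective (N.arrowMap p) := by
      obtain ⟨x, hx⟩ : ∃ x, N.arrowMap p x ≠ 0 := by
        by_contra! h'
        exact h0 (LinearMap.ext h')
      intro y
      obtain ⟨c, hc⟩ := exists_smul_eq_of_finrank_eq_one hfb hx y
      exact ⟨c • x, by rw [map_smul, hc]⟩
    exact ⟨(LinearMap.injective_iff_surjective_of_finrank_eq_finrank (hfa.trans hfb.symm)).2 hsurj,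
      hsurj⟩

lemma isInterval_intervalModule (i j : ℕ) :
    IsInterval (intervalModule k n α i j) i j where
  finrank_vec v := by
    change Module.finrank k (PLift (i ≤ v.val ∧ v.val ≤ j) → k) = _
    rw [Module.finrank_fintype_fun_eq_card]
    split_ifs with h
    · rw [Fintype.card_eq_one_iff]
      exact ⟨⟨h⟩, fun y => rfl⟩
    · rw [Fintype.card_eq_zero_iff]
      exact ⟨fun x => h x.down⟩
  bijective {a b} p ha ha' hb hb' := by
    rw [intervalModule, arrowMap_lift]
    refine ⟨fun x y hxy => ?_, fun y => ⟨fun _ => y ⟨hb, hb'⟩, ?_⟩⟩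
    · funext z
      have := congrFun hxy ⟨hb, hb'⟩
      change (if h : i ≤ a.val ∧ a.val ≤ j then
          (x : PLift (i ≤ a.val ∧ a.val ≤ j) → k) ⟨h⟩ else 0) =
        (if h : i ≤ a.val ∧ a.val ≤ j then
          (y : PLift (i ≤ a.val ∧ a.val ≤ j) → k) ⟨h⟩ else 0) at this
      rw [dif_pos ⟨ha, ha'⟩, dif_pos ⟨ha, ha'⟩] at this
      exact this
    · funext z
      change (if h : i ≤ a.val ∧ a.val ≤ j then
        (y : PLift (i ≤ b.val ∧ b.val ≤ j) → k) ⟨hb, hb'⟩ else 0) = _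
      rw [dif_pos ⟨ha, ha'⟩]

lemma IsInterval.tensor {X Y : FinRep k (TypeAVertex n α)} {s t s' t' : ℕ}
    (hX : IsInterval X s t) (hY : IsInterval Y s' t') :
    IsInterval (X ⊗ Y) (max s s') (min t t') where
  finrank_vec v := by
    change Module.finrank k (TensorProduct k (X.Vec v) (Y.Vec v)) = _
    rw [Module.finrank_tensorProduct, hX.finrank_vec, hY.finrank_vec]
    split_ifs <;> omega
  bijective {a b} p ha ha' hb hb' := by
    change Function.Bijective (TensorProduct.map (X.arrowMap p) (Y.arrowMap p))
    exact (TensorProduct.congr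
      (LinearEquiv.ofBijective _ (hX.bijective p (by omega) (by omega) (by omega) (by omega)))
      (LinearEquiv.ofBijective _
        (hY.bijective p (by omega) (by omega) (by omega) (by omega)))).bijective

end FinRep

/-! ### Upper and lower bounds in terms of intervals -/

namespace TypeAInterval

variable {n : ℕ} {α : ℕ → ArrowDir}

lemma leftKey_max_le {i s : ℕ} (h : i = 1 ∨ α (i - 1) = .right) (hs : 1 ≤ s) :
    leftKey α (max i s) ≤ leftKey α s := by
  rcases le_total i s with his | his
  · rw [max_eq_right his]
  · rw [max_eq_left his]
    rcases h with rfl | h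
    · rw [le_antisymm his hs]
    · unfold leftKey
      rw [if_pos h]
      split_ifs <;> omega

lemma le_leftKey_max {i s : ℕ} (h : i = 1 ∨ α (i - 1) = .left) (hs : 1 ≤ s) :
    leftKey α s ≤ leftKey α (max i s) := by
  rcases le_total i s with his | his
  · rw [max_eq_right his]
  · rw [max_eq_left his]
    rcases h with rfl | h
    · rw [le_antisymm his hs]
    · unfold leftKey
      rw [if_neg (c := α (i - 1) = .right) (by rw [h]; simp)]
      split_ifs <;> omega

lemma rightKey_min_le {j t : ℕ} (h : j = n ∨ α j = .left) (ht : t ≤ n) :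
    rightKey n α (min j t) ≤ rightKey n α t := by
  rcases le_total t j with hjt | hjt
  · rw [min_eq_right hjt]
  · rw [min_eq_left hjt]
    rcases h with rfl | h
    · rw [le_antisymm ht hjt]
    · unfold rightKey
      rw [if_neg (c := α j = .right) (by rw [h]; simp)]
      split_ifs <;> omega

lemma le_rightKey_min {j t : ℕ} (h : j = n ∨ α j = .right) (ht : t ≤ n) :
    rightKey n α t ≤ rightKey n α (min j t) := by
  rcases le_total t j with hjt | hjt
  · rw [min_eq_right hjt]
  · rw [min_eq_left hjt]
    rcases h with rfl | h
    · rw [le_antisymm ht hjt]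
    · unfold rightKey
      rw [if_pos h]
      split_ifs <;> omega

/-- The elements of a finite set can be listed by increasing key. -/
lemma exists_strictMono_key (S : Finset ℕ) (κ : ℕ → ℤ) (hκ : Set.InjOn κ S) {r : ℕ}
    (hr : r ≤ S.card) : ∃ s : Fin r → ℕ, (∀ a, s a ∈ S) ∧ StrictMono (κ ∘ s) := by
  have hcard : (S.image κ).card = S.card := Finset.card_image_of_injOn hκ
  let e := (S.image κ).orderEmbOfFin hcard
  have hmem : ∀ a : Fin r, ∃ x ∈ S, κ x = e (Fin.castLE hr a) := fun a =>
    Finset.mem_image.1 ((S.image κ).orderEmbOfFin_mem hcard _)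
  choose s hs hs' using hmem
  refine ⟨s, hs, fun a b hab => ?_⟩
  rw [Function.comp_apply, Function.comp_apply, hs', hs']
  exact e.strictMono hab

end TypeAInterval

namespace FinRep

open TypeAInterval FrobeniusPerron StalkTensor

variable {k : Type u} [Field k] {n : ℕ} {α : ℕ → ArrowDir}

/-- `X` is isomorphic to `M{s,t}` with `1 ≤ s ≤ t ≤ n`. -/
structure IsProperInterval (X : FinRep k (TypeAVertex n α)) (s t : ℕ) : Prop
    extends IsInterval X s t where
  one_le : 1 ≤ s
  le : s ≤ t
  le_n : t ≤ n

lemma isProperInterval_intervalModule {s t : ℕ} (hs : 1 ≤ s) (hst : s ≤ t) (ht : t ≤ n) :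
    IsProperInterval (intervalModule k n α s t) s t :=
  ⟨isInterval_intervalModule s t, hs, hst, ht⟩

namespace IsProperInterval

variable {X Y : FinRep k (TypeAVertex n α)} {s t s' t' i j : ℕ}

/-- The keys of orthogonal intersecting intervals are incomparable. -/
lemma not_keys_le (hX : IsProperInterval X s t) (hY : IsProperInterval Y s' t')
    (h : Module.finrank k (X ⟶ Y) = 0) (hC : max s s' ≤ min t t') :
    ¬ (leftKey α s ≤ leftKey α s' ∧ rightKey n α t ≤ rightKey n α t') := by
  intro h'
  rw [hX.finrank_hom_eq hY.toIsInterval hX.one_le hY.one_le hX.le_n hY.le_n hC, if_pos h'] at h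
  exact one_ne_zero h

lemma left_ne (hX : IsProperInterval X s t) (hY : IsProperInterval Y s' t')
    (h : Module.finrank k (X ⟶ Y) = 0) (h' : Module.finrank k (Y ⟶ X) = 0)
    (hC : max s s' ≤ min t t') : s ≠ s' := by
  rintro rfl
  rcases le_total (rightKey n α t) (rightKey n α t') with hle | hle
  · exact hX.not_keys_le hY h hC ⟨le_rfl, hle⟩
  · exact hY.not_keys_le hX h' (by omega) ⟨le_rfl, hle⟩

lemma right_ne (hX : IsProperInterval X s t) (hY : IsProperInterval Y s' t')
    (h : Module.finrank k (X ⟶ Y) = 0) (h' : Module.finrank k (Y ⟶ X) = 0)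
    (hC : max s s' ≤ min t t') : t ≠ t' := by
  rintro rfl
  rcases le_total (leftKey α s) (leftKey α s') with hle | hle
  · exact hX.not_keys_le hY h hC ⟨hle, le_rfl⟩
  · exact hY.not_keys_le hX h' (by omega) ⟨hle, le_rfl⟩

lemma finrank_hom_tensor_eq (hX : IsProperInterval X s t) (hY : IsProperInterval Y s' t')
    (hi : 1 ≤ i) (hj : j ≤ n) (hC : max s (max i s') ≤ min t (min j t')) :
    Module.finrank k (X ⟶ intervalModule k n α i j ⊗ Y) =
      if leftKey α s ≤ leftKey α (max i s') ∧ rightKey n α t ≤ rightKey n α (min j t') then 1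
      else 0 :=
  hX.finrank_hom_eq ((isInterval_intervalModule i j).tensor hY.toIsInterval) hX.one_le
    (le_max_of_le_left hi) hX.le_n (min_le_of_left_le hj) hC

lemma keys_of_finrank_hom_tensor_ne_zero (hX : IsProperInterval X s t)
    (hY : IsProperInterval Y s' t') (hi : 1 ≤ i) (hj : j ≤ n)
    (h : Module.finrank k (X ⟶ intervalModule k n α i j ⊗ Y) ≠ 0) :
    max s (max i s') ≤ min t (min j t') ∧ leftKey α s ≤ leftKey α (max i s') ∧
      rightKey n α t ≤ rightKey n α (min j t') := by
  have hC : max s (max i s') ≤ min t (min j t') := by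
    by_contra hC
    exact h (hX.finrank_hom_of_disjoint
      ((isInterval_intervalModule i j).tensor hY.toIsInterval) (not_le.1 hC))
  rw [hX.finrank_hom_tensor_eq hY hi hj hC] at h
  exact ⟨hC, by_contra fun h' => h (if_neg h')⟩

variable [HasDerivedCategory.{w} (FinRep k (TypeAVertex n α))]

lemma extDim_tensor_eq (hX : IsProperInterval X s t) (hY : IsProperInterval Y s' t')
    (hi : 1 ≤ i) (hj : j ≤ n) (hC : max s (max i s') ≤ min t (min j t')) :
    DerivedCategory.extDim k X (intervalModule k n α i j ⊗ Y) =
      if leftKey α (max i s') < leftKey α s ∧ rightKey n α (min j t') < rightKey n α t then 1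
      else 0 :=
  hX.extDim_eq_ite ((isInterval_intervalModule i j).tensor hY.toIsInterval) hX.one_le
    (le_max_of_le_left hi) hX.le_n (min_le_of_left_le hj) hC

lemma keys_of_extDim_tensor_ne_zero (hX : IsProperInterval X s t)
    (hY : IsProperInterval Y s' t') (hi : 1 ≤ i) (hj : j ≤ n)
    (h : DerivedCategory.extDim k X (intervalModule k n α i j ⊗ Y) ≠ 0) :
    (max s (max i s') ≤ min t (min j t') ∧ leftKey α (max i s') < leftKey α s ∧
      rightKey n α (min j t') < rightKey n α t) ∨
    (max i s' ≤ min j t' ∧ ((t + 1 = max i s' ∧ α t = .right) ∨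
      (min j t' + 1 = s ∧ α (min j t') = .left))) := by
  by_cases hC : max s (max i s') ≤ min t (min j t')
  · left
    rw [hX.extDim_tensor_eq hY hi hj hC] at h
    exact ⟨hC, by_contra fun h' => h (if_neg h')⟩
  · right
    exact (hX.adjacent_of_extDim_ne_zero
      ((isInterval_intervalModule i j).tensor hY.toIsInterval) (not_le.1 hC) h).2

end IsProperInterval

variable [HasDerivedCategory.{w} (FinRep k (TypeAVertex n α))]

/-- The upper bound for `fpd(M[m])` in terms of a level function `ψ` on intervals: nonzero entries
of adjacency matrices do not raise the level, and in each row at most `R` entries, all equal to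
`1`, preserve it. The degrees of the stalk complexes form a coarser level. -/
lemma fpdStalk_le (M : FinRep k (TypeAVertex n α)) (m : ℤ) (ψ : ℕ → ℕ → ℤ) (R : ℕ)
    (hψ : ∀ {X Y : FinRep k (TypeAVertex n α)} {s t s' t' : ℕ}, IsProperInterval X s t →
      IsProperInterval Y s' t' → stalkHomDim M m k 0 X 0 Y ≠ 0 → ψ s' t' ≤ ψ s t ∧
        (ψ s' t' = ψ s t → stalkHomDim M m k 0 X 0 Y ≤ 1))
    (hR : ∀ {r : ℕ} (N : Fin r → FinRep k (TypeAVertex n α)) (s t : Fin r → ℕ) (a : Fin r)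
      (T : Finset (Fin r)), (∀ x, IsProperInterval (N x) (s x) (t x)) →
      (∀ x ∈ insert a T, ∀ y ∈ insert a T, x ≠ y → Module.finrank k (N x ⟶ N y) = 0) →
      (∀ b ∈ T, stalkHomDim M m k 0 (N a) 0 (N b) ≠ 0 ∧ ψ (s b) (t b) = ψ (s a) (t a)) →
      T.card ≤ R) :
    fpdStalk k M m ≤ R := by
  refine fpd_boundedTensorStalk_le M m k hasTwoTermProjectiveResolutions R fun r d N hN horth => ?_
  choose s t hs hst ht hI using fun a => exists_isInterval_of_isBrick (hN a)
  have hP : ∀ x, IsProperInterval (N x) (s x) (t x) := fun x => ⟨hI x, hs x, hst x, ht x⟩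
  have hself : ∀ (d : ℤ) (X Y : FinRep k (TypeAVertex n α)),
      stalkHomDim M m k d X d Y = stalkHomDim M m k 0 X 0 Y := fun d X Y => by
    unfold stalkHomDim
    have h1 : d - m = d ↔ 0 - m = 0 := by omega
    have h2 : d - m + 1 = d ↔ 0 - m + 1 = 0 := by omega
    simp only [h1, h2]
  have hdeg : ∀ (d d' : ℤ) (X Y : FinRep k (TypeAVertex n α)),
      stalkHomDim M m k d X d' Y ≠ 0 → d' = d + m ∨ d' = d + m - 1 := fun d d' X Y h => by
    unfold stalkHomDim at h
    split_ifs at h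
    · omega
    · omega
    · exact absurd rfl h
  let f : ℤ → ℤ := fun d => if m ≤ 0 then d else -d
  have hf : ∀ d d', f d' = f d → d' = d := fun d d' h => by
    simp only [f] at h
    split_ifs at h <;> omega
  refine Matrix.spectralRadius_le_of_level _ (fun a => toLex (f (d a), ψ (s a) (t a))) R ?_ ?_
  · intro a b hab
    rw [Matrix.of_apply] at hab
    rw [Prod.Lex.toLex_le_toLex]
    by_cases hd : d b = d a
    · rw [hd, hself] at hab
      exact Or.inr ⟨by rw [hd], (hψ (hP a) (hP b) hab).1⟩
    · left
      have := hdeg _ _ _ _ hab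
      simp only [f]
      split_ifs <;> omega
  · intro a
    classical
    let T : Finset (Fin r) := Finset.univ.filter fun b =>
      (d b = d a ∧ ψ (s b) (t b) = ψ (s a) (t a)) ∧ stalkHomDim M m k 0 (N a) 0 (N b) ≠ 0
    have hT : ∀ b, b ∈ T ↔ (d b = d a ∧ ψ (s b) (t b) = ψ (s a) (t a)) ∧
        stalkHomDim M m k 0 (N a) 0 (N b) ≠ 0 := fun b => by simp [T]
    have hcard : T.card ≤ R := by
      refine hR N s t a T hP (fun x hx y hy hxy => ?_) fun b hb => ?_
      · have hdx : ∀ x ∈ insert a T, d x = d a := fun x hx => by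
          rcases Finset.mem_insert.1 hx with rfl | hx
          · rfl
          · exact ((hT x).1 hx).1.1
        have : Subsingleton (N x ⟶ N y) := subsingleton_of_forall_eq 0
          (horth x y hxy ((hdx x hx).trans (hdx y hy).symm))
        exact Module.finrank_zero_of_subsingleton
      · exact ⟨((hT b).1 hb).2, ((hT b).1 hb).1.2⟩
    refine le_trans ?_ hcard
    rw [Finset.card_eq_sum_ones, Finset.sum_filter, Finset.sum_filter]
    refine Finset.sum_le_sum fun b _ => ?_
    rw [Matrix.of_apply]
    split_ifs with h1 h2 h2
    · have h3 := (hT b).1 (by simpa [T] using h2)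
      rw [h3.1.1, hself]
      exact (hψ (hP a) (hP b) h3.2).2 h3.1.2
    · have h3 := Prod.mk.inj (toLex.injective h1)
      have hd := hf _ _ h3.1
      rw [hd, hself]
      by_contra h4
      exact h2 ⟨⟨hd, h3.2⟩, by omega⟩
    · omega
    · exact le_rfl

/-- The lower bound for `fpd(M[m])` from a family of orthogonal intervals for which all entries of
the adjacency matrix are `1`. -/
lemma le_fpdStalk (M : FinRep k (TypeAVertex n α)) (m : ℤ) {r : ℕ} (s t : Fin r → ℕ)
    (hst : ∀ a, 1 ≤ s a ∧ s a ≤ t a ∧ t a ≤ n) (hC : ∀ a b, s a ≤ t b)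
    (hs : StrictMono (leftKey α ∘ s)) (ht : StrictAnti (rightKey n α ∘ t))
    (h1 : ∀ a b, stalkHomDim M m k 0 (intervalModule k n α (s a) (t a)) 0
      (intervalModule k n α (s b) (t b)) = 1) :
    (r : ℝ≥0∞) ≤ fpdStalk k M m := by
  have hP := fun a => isProperInterval_intervalModule (k := k) (α := α) (hst a).1 (hst a).2.1
    (hst a).2.2
  refine le_trans (Matrix.le_spectralRadius_of_forall_eq_one _ fun a b => ?_)
    (le_fpd_boundedTensorStalk M m k hasTwoTermProjectiveResolutions
      (fun a => intervalModule k n α (s a) (t a)) ⟨fun a => ?_, fun a b hab => ?_⟩)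
  · exact h1 a b
  · exact (hP a).isBrick (hst a).1 (hst a).2.1 (hst a).2.2
  · have h0 : Module.finrank k (intervalModule k n α (s a) (t a) ⟶
        intervalModule k n α (s b) (t b)) = 0 := by
      have hab1 := hC a b
      have hab2 := hC b a
      have ha := (hst a).2.1
      have hb := (hst b).2.1
      rw [(hP a).finrank_hom_eq (hP b).toIsInterval (hst a).1 (hst b).1 (hst a).2.2 (hst b).2.2
        (by omega), if_neg]
      rintro ⟨hle, hle'⟩
      rcases lt_or_gt_of_ne hab with hlt | hlt
      · exact absurd hle' (not_le.2 (ht hlt))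
      · exact absurd hle (not_le.2 (hs hlt))
    have := Module.finrank_zero_iff.1 h0
    exact fun f => Subsingleton.elim _ _

end FinRep

/-! ### Sinks, sources and flows -/

namespace TypeAInterval

variable {n : ℕ} {α : ℕ → ArrowDir}

lemma leftKey_max_le_leftKey_max {i s s' : ℕ} (h : i = 1 ∨ α (i - 1) = .left) (hs : 1 ≤ s)
    (h' : leftKey α s ≤ leftKey α (max i s')) : leftKey α (max i s) ≤ leftKey α (max i s') := by
  rcases le_or_gt i s with his | his
  · rwa [max_eq_right his]
  · rw [max_eq_left his.le]
    have hα : ¬ α (i - 1) = .right := by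
      rw [h.resolve_left (by omega)]
      simp
    have hx := le_max_left i s'
    generalize max i s' = x at h' hx
    unfold leftKey at h' ⊢
    rw [if_neg hα]
    split_ifs at h' ⊢ <;> omega

lemma rightKey_min_le_rightKey_min {j t t' : ℕ} (h : j = n ∨ α j = .right) (ht : t ≤ n)
    (h' : rightKey n α t ≤ rightKey n α (min j t')) :
    rightKey n α (min j t) ≤ rightKey n α (min j t') := by
  rcases le_or_gt t j with hjt | hjt
  · rwa [min_eq_right hjt]
  · rw [min_eq_left hjt.le]
    have hα : α j = .right := h.resolve_left (by omega)
    have hx := min_le_left j t'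
    generalize min j t' = x at h' hx
    unfold rightKey at h' ⊢
    rw [if_pos hα]
    split_ifs at h' ⊢ <;> omega

/-- The position of the left end of an interval relative to `[i, j]`, when no arrow leaves `[i, j]`
at its left end: the parity records whether the left end lies outside of `[i, j]`. -/
def leftLevel (α : ℕ → ArrowDir) (i s : ℕ) : ℤ :=
  2 * leftKey α (max i s) + if s < i then 1 else 0

/-- The mirror image of `leftLevel`. -/
def rightLevel (n : ℕ) (α : ℕ → ArrowDir) (j t : ℕ) : ℤ :=
  2 * rightKey n α (min j t) + if j < t then 1 else 0

lemma leftLevel_le {i s s' : ℕ} (h : i = 1 ∨ α (i - 1) = .right) (hs : 1 ≤ s)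
    (h' : leftKey α (max i s') < leftKey α s) :
    leftLevel α i s' ≤ leftLevel α i s ∧ (leftLevel α i s' = leftLevel α i s → s < i ∧ s' < i) := by
  unfold leftLevel
  rcases le_or_gt i s with his | his
  · rw [max_eq_right his]
    split_ifs <;> omega
  · rw [max_eq_left his.le]
    have hα : α (i - 1) = .right := h.resolve_left (by omega)
    have hle : leftKey α (max i s') ≤ leftKey α i := by
      have hx := le_max_left i s'
      generalize max i s' = x at h' hx
      unfold leftKey at h' ⊢
      rw [if_pos hα]
      split_ifs at h' ⊢ <;> omega
    split_ifs <;> omega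

lemma rightLevel_le {j t t' : ℕ} (h : j = n ∨ α j = .left) (ht : t ≤ n)
    (h' : rightKey n α (min j t') < rightKey n α t) :
    rightLevel n α j t' ≤ rightLevel n α j t ∧
      (rightLevel n α j t' = rightLevel n α j t → j < t ∧ j < t') := by
  unfold rightLevel
  rcases le_or_gt t j with hjt | hjt
  · rw [min_eq_right hjt]
    split_ifs <;> omega
  · rw [min_eq_left hjt.le]
    have hα : ¬ α j = .right := by
      rw [h.resolve_left (by omega)]
      simp
    have hle : rightKey n α (min j t') ≤ rightKey n α j := by
      have hx := min_le_left j t'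
      generalize min j t' = x at h' hx
      unfold rightKey at h' ⊢
      rw [if_neg hα]
      split_ifs at h' ⊢ <;> omega
    split_ifs <;> omega

end TypeAInterval

namespace FinRep

open TypeAInterval FrobeniusPerron StalkTensor

variable {k : Type u} [Field k] {n : ℕ} {α : ℕ → ArrowDir}

namespace IsProperInterval

variable {r : ℕ} {N : Fin r → FinRep k (TypeAVertex n α)} {s t : Fin r → ℕ} {T : Finset (Fin r)}

/-- Orthogonal intervals which intersect pairwise have distinct left ends. -/
lemma card_le_of_left_mem (hP : ∀ x, IsProperInterval (N x) (s x) (t x))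
    (horth : ∀ x ∈ T, ∀ y ∈ T, x ≠ y → Module.finrank k (N x ⟶ N y) = 0) {S : Finset ℕ}
    (hC : ∀ x ∈ T, ∀ y ∈ T, s x ≤ t y) (hS : ∀ x ∈ T, s x ∈ S) : T.card ≤ S.card := by
  refine Finset.card_le_card_of_injOn s hS fun x hx y hy hxy => ?_
  by_contra hne
  have h1 := hC x hx y hy
  have h2 := hC y hy x hx
  have h3 := (hP x).le
  have h4 := (hP y).le
  exact (hP x).left_ne (hP y) (horth x hx y hy hne) (horth y hy x hx (Ne.symm hne)) (by omega) hxy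

/-- Orthogonal intervals which intersect pairwise have distinct right ends. -/
lemma card_le_of_right_mem (hP : ∀ x, IsProperInterval (N x) (s x) (t x))
    (horth : ∀ x ∈ T, ∀ y ∈ T, x ≠ y → Module.finrank k (N x ⟶ N y) = 0) {S : Finset ℕ}
    (hC : ∀ x ∈ T, ∀ y ∈ T, s x ≤ t y) (hS : ∀ x ∈ T, t x ∈ S) : T.card ≤ S.card := by
  refine Finset.card_le_card_of_injOn t hS fun x hx y hy hxy => ?_
  by_contra hne
  have h1 := hC x hx y hy
  have h2 := hC y hy x hx
  have h3 := (hP x).le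
  have h4 := (hP y).le
  exact (hP x).right_ne (hP y) (horth x hx y hy hne) (horth y hy x hx (Ne.symm hne)) (by omega) hxy

lemma finrank_hom_tensor_le_one {X Y : FinRep k (TypeAVertex n α)}
    {s t s' t' i j : ℕ} (hX : IsProperInterval X s t) (hY : IsProperInterval Y s' t') (hi : 1 ≤ i)
    (hj : j ≤ n) : Module.finrank k (X ⟶ intervalModule k n α i j ⊗ Y) ≤ 1 := by
  by_cases h : Module.finrank k (X ⟶ intervalModule k n α i j ⊗ Y) = 0
  · omega
  · rw [hX.finrank_hom_tensor_eq hY hi hj (hX.keys_of_finrank_hom_tensor_ne_zero hY hi hj h).1]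
    split_ifs <;> omega

/-- If `Ext¹(X, M{i,j} ⊗ Y)` is nonzero, then both keys drop strictly, also when the intervals are
disjoint. -/
lemma keys_lt_of_extDim_tensor_ne_zero [HasDerivedCategory.{w} (FinRep k (TypeAVertex n α))]
    {X Y : FinRep k (TypeAVertex n α)} {s t s' t' i j : ℕ} (hX : IsProperInterval X s t)
    (hY : IsProperInterval Y s' t') (hi : 1 ≤ i) (hj : j ≤ n)
    (h : DerivedCategory.extDim k X (intervalModule k n α i j ⊗ Y) ≠ 0) :
    leftKey α (max i s') < leftKey α s ∧ rightKey n α (min j t') < rightKey n α t := by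
  have hs := hX.one_le
  have hst := hX.le
  have ht := hX.le_n
  rcases hX.keys_of_extDim_tensor_ne_zero hY hi hj h with h | ⟨hle, ⟨h1, hα⟩ | ⟨h1, hα⟩⟩
  · exact h.2
  · have hy : min j t' ≤ n := by omega
    rw [← h1] at hle ⊢
    generalize min j t' = y at hle hy ⊢
    unfold leftKey rightKey
    rw [Nat.add_sub_cancel, if_pos hα]
    constructor <;> split_ifs <;> omega
  · have hx : 1 ≤ max i s' := by omega
    subst h1
    generalize min j t' = y at hle hst hα ⊢
    generalize max i s' = x at hle hx ⊢
    unfold leftKey rightKey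
    have hα' : ¬ α y = .right := by
      rw [hα]
      simp
    rw [Nat.add_sub_cancel, if_neg hα']
    constructor <;> split_ifs <;> omega

end IsProperInterval

variable [HasDerivedCategory.{w} (FinRep k (TypeAVertex n α))] {i j : ℕ}

lemma stalkHomDim_shift_zero (M X Y : FinRep k (TypeAVertex n α)) :
    stalkHomDim M 0 k 0 X 0 Y = Module.finrank k (X ⟶ M ⊗ Y) :=
  if_pos (sub_zero 0)

lemma stalkHomDim_shift_one (M X Y : FinRep k (TypeAVertex n α)) :
    stalkHomDim M 1 k 0 X 0 Y = DerivedCategory.extDim k X (M ⊗ Y) := by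
  unfold stalkHomDim
  rw [if_neg (by omega), if_pos (by omega)]

lemma fpdStalk_eq_zero_of_shift (M : FinRep k (TypeAVertex n α)) {m : ℤ} (hm : m < 0 ∨ 1 < m) :
    fpdStalk k M m = 0 := by
  have h0 : ∀ X Y : FinRep k (TypeAVertex n α), stalkHomDim M m k 0 X 0 Y = 0 := fun X Y => by
    unfold stalkHomDim
    rw [if_neg (by omega), if_neg (by omega)]
  refine le_antisymm ?_ zero_le
  have h := fpdStalk_le M m (fun _ _ => 0) 0 (fun _ _ h => absurd (h0 _ _) h)
    (fun _ _ _ _ T _ _ h => by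
      rw [Finset.card_eq_zero.2 (Finset.eq_empty_of_forall_notMem fun b hb =>
        (h b hb).1 (h0 _ _))])
  rwa [Nat.cast_zero] at h

/-- If no arrow leaves `[i, j]` at its left end, then the left keys do not decrease along nonzero
morphisms `X ⟶ M{i,j} ⊗ Y`, and strictly increase between distinct orthogonal intervals. -/
lemma fpdStalk_zero_le_one_of_left (hi : 1 ≤ i) (hj : j ≤ n)
    (h : i = 1 ∨ α (i - 1) = .right) : fpdStalk k (intervalModule k n α i j) 0 ≤ 1 := by
  rw [← Nat.cast_one]
  refine fpdStalk_le _ 0 (fun s _ => -leftKey α s) 1 (fun hX hY hne => ?_)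
    (fun N s t a T hP horth hT => ?_)
  · rw [stalkHomDim_shift_zero] at hne ⊢
    have h1 := hX.keys_of_finrank_hom_tensor_ne_zero hY hi hj hne
    exact ⟨neg_le_neg (h1.2.1.trans (leftKey_max_le h hY.one_le)),
      fun _ => hX.finrank_hom_tensor_le_one hY hi hj⟩
  · rw [← Finset.card_singleton a]
    refine Finset.card_le_card fun b hb => Finset.mem_singleton.2 (by_contra fun hba => ?_)
    have hab : a ≠ b := Ne.symm hba
    have h1 := (hT b hb).1
    rw [stalkHomDim_shift_zero] at h1
    have h2 := (hP a).keys_of_finrank_hom_tensor_ne_zero (hP b) hi hj h1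
    exact (hP a).left_ne (hP b) (horth a (by simp) b (by simp [hb]) hab)
      (horth b (by simp [hb]) a (by simp) hba) (by omega)
      (leftKey_injective (hP a).one_le (hP b).one_le (neg_injective (hT b hb).2).symm)

/-- The mirror image of `fpdStalk_zero_le_one_of_left`. -/
lemma fpdStalk_zero_le_one_of_right (hi : 1 ≤ i) (hj : j ≤ n)
    (h : j = n ∨ α j = .left) : fpdStalk k (intervalModule k n α i j) 0 ≤ 1 := by
  rw [← Nat.cast_one]
  refine fpdStalk_le _ 0 (fun _ t => -rightKey n α t) 1 (fun hX hY hne => ?_)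
    (fun N s t a T hP horth hT => ?_)
  · rw [stalkHomDim_shift_zero] at hne ⊢
    have h1 := hX.keys_of_finrank_hom_tensor_ne_zero hY hi hj hne
    exact ⟨neg_le_neg (h1.2.2.trans (rightKey_min_le h hY.le_n)),
      fun _ => hX.finrank_hom_tensor_le_one hY hi hj⟩
  · rw [← Finset.card_singleton a]
    refine Finset.card_le_card fun b hb => Finset.mem_singleton.2 (by_contra fun hba => ?_)
    have hab : a ≠ b := Ne.symm hba
    have h1 := (hT b hb).1
    rw [stalkHomDim_shift_zero] at h1
    have h2 := (hP a).keys_of_finrank_hom_tensor_ne_zero (hP b) hi hj h1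
    exact (hP a).right_ne (hP b) (horth a (by simp) b (by simp [hb]) hab)
      (horth b (by simp [hb]) a (by simp) hba) (by omega)
      (rightKey_injective (hP a).le_n (hP b).le_n (neg_injective (hT b hb).2).symm)

/-- The brick set `{M{i,j}}` shows `1 ≤ fpd(M{i,j})`. -/
lemma one_le_fpdStalk_zero (hi : 1 ≤ i) (hij : i ≤ j) (hj : j ≤ n) :
    1 ≤ fpdStalk k (intervalModule k n α i j) 0 := by
  have hP := isProperInterval_intervalModule (k := k) (α := α) hi hij hj
  have h := le_fpdStalk (intervalModule k n α i j) 0 (r := 1) (fun _ => i) (fun _ => j)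
    (fun _ => ⟨hi, hij, hj⟩) (fun _ _ => hij) (Subsingleton.strictMono _)
    (Subsingleton.strictAnti _) fun _ _ => by
      rw [stalkHomDim_shift_zero, hP.finrank_hom_tensor_eq hP hi hj (by omega), if_pos]
      simp
  rwa [Nat.cast_one] at h

/-- The upper bound for sources: the keys of the intersections with `[i, j]` do not decrease along
nonzero morphisms, and the orthogonal intervals at one level contain `[i, j]`, unless there is only
one. -/
lemma fpdStalk_zero_le_of_isSourceInterval (hi : 1 ≤ i) (hij : i ≤ j) (hj : j ≤ n)
    (h : IsSourceInterval n α i j) :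
    fpdStalk k (intervalModule k n α i j) 0 ≤ ((min i (n - j + 1) : ℕ) : ℝ≥0∞) := by
  refine fpdStalk_le _ 0 (fun s t => -(leftKey α (max i s) + rightKey n α (min j t))) _
    (fun hX hY hne => ?_) (fun N s t a T hP horth hT => ?_)
  · rw [stalkHomDim_shift_zero] at hne ⊢
    have h1 := (hX.keys_of_finrank_hom_tensor_ne_zero hY hi hj hne).2
    have h2 := leftKey_max_le_leftKey_max h.1 hX.one_le h1.1
    have h3 := rightKey_min_le_rightKey_min h.2 hX.le_n h1.2
    exact ⟨by omega, fun _ => hX.finrank_hom_tensor_le_one hY hi hj⟩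
  · have hmem : ∀ b ∈ T, max (s a) (max i (s b)) ≤ min (t a) (min j (t b)) ∧
        max i (s a) = max i (s b) ∧ min j (t a) = min j (t b) := fun b hb => by
      obtain ⟨hne, heq⟩ := hT b hb
      rw [stalkHomDim_shift_zero] at hne
      obtain ⟨hC, h1⟩ := (hP a).keys_of_finrank_hom_tensor_ne_zero (hP b) hi hj hne
      have h2 := leftKey_max_le_leftKey_max h.1 (hP a).one_le h1.1
      have h3 := rightKey_min_le_rightKey_min h.2 (hP a).le_n h1.2
      exact ⟨hC, leftKey_injective (α := α) (le_max_of_le_left hi)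
          (le_max_of_le_left hi) (by omega),
        rightKey_injective (α := α) (min_le_of_left_le hj) (min_le_of_left_le hj) (by omega)⟩
    by_cases hTa : T ⊆ {a}
    · refine (Finset.card_le_card hTa).trans ?_
      rw [Finset.card_singleton]
      omega
    · obtain ⟨b, hb, hba⟩ := Finset.not_subset.1 hTa
      have hba : b ≠ a := fun h => hba (Finset.mem_singleton.2 h)
      obtain ⟨hC, hl, hr⟩ := hmem b hb
      have h1 := horth a (by simp) b (by simp [hb]) hba.symm
      have h2 := horth b (by simp [hb]) a (by simp) hba
      have h3 := (hP a).left_ne (hP b) h1 h2 (by omega)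
      have h4 := (hP a).right_ne (hP b) h1 h2 (by omega)
      have hsT : ∀ x ∈ T, s x ≤ i := fun x hx => by
        have := hmem x hx
        omega
      have htT : ∀ x ∈ T, j ≤ t x := fun x hx => by
        have := hmem x hx
        omega
      have hCT : ∀ x ∈ T, ∀ y ∈ T, s x ≤ t y := fun x hx y hy =>
        (hsT x hx).trans (hij.trans (htT y hy))
      have horth' : ∀ x ∈ T, ∀ y ∈ T, x ≠ y → Module.finrank k (N x ⟶ N y) = 0 :=
        fun x hx y hy => horth x (Finset.mem_insert_of_mem hx) y (Finset.mem_insert_of_mem hy)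
      refine le_min ?_ ?_
      · have := IsProperInterval.card_le_of_left_mem (S := Finset.Icc 1 i) hP horth' hCT
          fun x hx => Finset.mem_Icc.2 ⟨(hP x).one_le, hsT x hx⟩
        rwa [Nat.card_Icc, Nat.add_sub_cancel] at this
      · have := IsProperInterval.card_le_of_right_mem (S := Finset.Icc j n) hP horth' hCT
          fun x hx => Finset.mem_Icc.2 ⟨htT x hx, (hP x).le_n⟩
        rw [Nat.card_Icc] at this
        omega

/-- The lower bound for sources: `min i (n - j + 1)` orthogonal intervals containing `[i, j]`. -/
lemma le_fpdStalk_zero_of_isSourceInterval (hi : 1 ≤ i) (hij : i ≤ j) (hj : j ≤ n)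
    (h : IsSourceInterval n α i j) :
    ((min i (n - j + 1) : ℕ) : ℝ≥0∞) ≤ fpdStalk k (intervalModule k n α i j) 0 := by
  obtain ⟨s, hsS, hs⟩ := exists_strictMono_key (Finset.Icc 1 i) (leftKey α)
    (fun x hx y hy => leftKey_injective (Finset.mem_Icc.1 hx).1 (Finset.mem_Icc.1 hy).1)
    (r := min i (n - j + 1)) (by rw [Nat.card_Icc]; omega)
  obtain ⟨t, htS, ht⟩ := exists_strictMono_key (Finset.Icc j n) (fun t => -rightKey n α t)
    (fun x hx y hy hxy => rightKey_injective (Finset.mem_Icc.1 hx).2 (Finset.mem_Icc.1 hy).2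
      (neg_injective hxy)) (r := min i (n - j + 1)) (by rw [Nat.card_Icc]; omega)
  simp only [Finset.mem_Icc] at hsS htS
  have hst : ∀ a, 1 ≤ s a ∧ s a ≤ t a ∧ t a ≤ n := fun a =>
    ⟨(hsS a).1, (hsS a).2.trans (hij.trans (htS a).1), (htS a).2⟩
  have hP := fun a => isProperInterval_intervalModule (k := k) (α := α) (hst a).1 (hst a).2.1
    (hst a).2.2
  refine le_fpdStalk _ 0 s t hst (fun a b => (hsS a).2.trans (hij.trans (htS b).1)) hs
    (fun a b hab => neg_lt_neg_iff.1 (ht hab)) fun a b => ?_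
  have ha := hsS a
  have hb := hsS b
  have ha' := htS a
  have hb' := htS b
  rw [stalkHomDim_shift_zero, (hP a).finrank_hom_tensor_eq (hP b) hi hj (by omega), if_pos]
  have h1 := le_leftKey_max h.1 ha.1
  have h2 := le_rightKey_min h.2 ha'.2
  rw [max_eq_left ha.2] at h1
  rw [min_eq_left ha'.1] at h2
  rw [max_eq_left hb.2, min_eq_left hb'.1]
  exact ⟨h1, h2⟩

lemma IsProperInterval.extDim_tensor_le_one {X Y : FinRep k (TypeAVertex n α)} {s t s' t' : ℕ}
    (hX : IsProperInterval X s t) (hY : IsProperInterval Y s' t') (hi : 1 ≤ i) (hj : j ≤ n)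
    (hC : max s (max i s') ≤ min t (min j t')) :
    DerivedCategory.extDim k X (intervalModule k n α i j ⊗ Y) ≤ 1 := by
  rw [hX.extDim_tensor_eq hY hi hj hC]
  split_ifs <;> omega

/-- If no arrow enters `[i, j]` at its left end, then the left keys of the ends drop strictly along
nonzero extensions of `X` by `M{i,j} ⊗ Y`, and the adjacency matrices are nilpotent. -/
lemma fpdStalk_one_eq_zero_of_left (hi : 1 ≤ i) (hj : j ≤ n) (h : i = 1 ∨ α (i - 1) = .left) :
    fpdStalk k (intervalModule k n α i j) 1 = 0 := by
  have hlt : ∀ {X Y : FinRep k (TypeAVertex n α)} {s t s' t' : ℕ}, IsProperInterval X s t →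
      IsProperInterval Y s' t' → stalkHomDim (intervalModule k n α i j) 1 k 0 X 0 Y ≠ 0 →
      leftKey α s' < leftKey α s := fun hX hY hne => by
    rw [stalkHomDim_shift_one] at hne
    exact (le_leftKey_max h hY.one_le).trans_lt
      (hX.keys_lt_of_extDim_tensor_ne_zero hY hi hj hne).1
  refine le_antisymm ?_ zero_le
  rw [← Nat.cast_zero]
  refine fpdStalk_le _ 1 (fun s _ => leftKey α s) 0
    (fun hX hY hne => ⟨(hlt hX hY hne).le, fun heq => absurd heq (hlt hX hY hne).ne⟩)
    (fun N s t a T hP _ hT => ?_)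
  rw [Finset.card_eq_zero.2 (Finset.eq_empty_of_forall_notMem fun b hb =>
    (hlt (hP a) (hP b) (hT b hb).1).ne (hT b hb).2)]

/-- The mirror image of `fpdStalk_one_eq_zero_of_left`. -/
lemma fpdStalk_one_eq_zero_of_right (hi : 1 ≤ i) (hj : j ≤ n) (h : j = n ∨ α j = .right) :
    fpdStalk k (intervalModule k n α i j) 1 = 0 := by
  have hlt : ∀ {X Y : FinRep k (TypeAVertex n α)} {s t s' t' : ℕ}, IsProperInterval X s t →
      IsProperInterval Y s' t' → stalkHomDim (intervalModule k n α i j) 1 k 0 X 0 Y ≠ 0 →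
      rightKey n α t' < rightKey n α t := fun hX hY hne => by
    rw [stalkHomDim_shift_one] at hne
    exact (le_rightKey_min h hY.le_n).trans_lt
      (hX.keys_lt_of_extDim_tensor_ne_zero hY hi hj hne).2
  refine le_antisymm ?_ zero_le
  rw [← Nat.cast_zero]
  refine fpdStalk_le _ 1 (fun _ t => rightKey n α t) 0
    (fun hX hY hne => ⟨(hlt hX hY hne).le, fun heq => absurd heq (hlt hX hY hne).ne⟩)
    (fun N s t a T hP _ hT => ?_)
  rw [Finset.card_eq_zero.2 (Finset.eq_empty_of_forall_notMem fun b hb =>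
    (hlt (hP a) (hP b) (hT b hb).1).ne (hT b hb).2)]

/-- The upper bound for sinks in degree one: the levels of the ends do not increase along nonzero
extensions of `X` by `M{i,j} ⊗ Y`, and are preserved only if both intervals extend beyond `[i, j]`
on both sides. -/
lemma fpdStalk_one_le_of_isSinkInterval (hi : 1 ≤ i) (hij : i ≤ j) (hj : j ≤ n)
    (h : IsSinkInterval n α i j) :
    fpdStalk k (intervalModule k n α i j) 1 ≤ ((min (i - 1) (n - j) : ℕ) : ℝ≥0∞) := by
  have hlevel : ∀ {X Y : FinRep k (TypeAVertex n α)} {s t s' t' : ℕ}, IsProperInterval X s t →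
      IsProperInterval Y s' t' → stalkHomDim (intervalModule k n α i j) 1 k 0 X 0 Y ≠ 0 →
      leftLevel α i s' + rightLevel n α j t' ≤ leftLevel α i s + rightLevel n α j t ∧
        (leftLevel α i s' + rightLevel n α j t' = leftLevel α i s + rightLevel n α j t →
          (s < i ∧ s' < i) ∧ j < t ∧ j < t') := fun hX hY hne => by
    rw [stalkHomDim_shift_one] at hne
    have h1 := hX.keys_lt_of_extDim_tensor_ne_zero hY hi hj hne
    have h2 := leftLevel_le h.1 hX.one_le h1.1
    have h3 := rightLevel_le h.2 hX.le_n h1.2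
    exact ⟨by omega, fun heq => ⟨h2.2 (by omega), h3.2 (by omega)⟩⟩
  refine fpdStalk_le _ 1 (fun s t => leftLevel α i s + rightLevel n α j t) _
    (fun hX hY hne => ⟨(hlevel hX hY hne).1, fun heq => ?_⟩) (fun N s t a T hP horth hT => ?_)
  · have h1 := (hlevel hX hY hne).2 heq
    rw [stalkHomDim_shift_one]
    exact hX.extDim_tensor_le_one hY hi hj (by omega)
  · have hT' : ∀ b ∈ T, s b < i ∧ j < t b := fun b hb => by
      have h1 := (hlevel (hP a) (hP b) (hT b hb).1).2 (hT b hb).2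
      exact ⟨h1.1.2, h1.2.2⟩
    have hCT : ∀ x ∈ T, ∀ y ∈ T, s x ≤ t y := fun x hx y hy =>
      (hT' x hx).1.le.trans (hij.trans (hT' y hy).2.le)
    have horth' : ∀ x ∈ T, ∀ y ∈ T, x ≠ y → Module.finrank k (N x ⟶ N y) = 0 :=
      fun x hx y hy => horth x (Finset.mem_insert_of_mem hx) y (Finset.mem_insert_of_mem hy)
    refine le_min ?_ ?_
    · have := IsProperInterval.card_le_of_left_mem (S := Finset.Ico 1 i) hP horth' hCT
        fun x hx => Finset.mem_Ico.2 ⟨(hP x).one_le, (hT' x hx).1⟩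
      rwa [Nat.card_Ico] at this
    · have := IsProperInterval.card_le_of_right_mem (S := Finset.Ioc j n) hP horth' hCT
        fun x hx => Finset.mem_Ioc.2 ⟨(hT' x hx).2, (hP x).le_n⟩
      rwa [Nat.card_Ioc] at this

/-- The lower bound for sinks in degree one: `min (i - 1) (n - j)` orthogonal intervals which extend
beyond `[i, j]` on both sides. -/
lemma le_fpdStalk_one_of_isSinkInterval (hi : 1 ≤ i) (hij : i ≤ j) (hj : j ≤ n)
    (h : IsSinkInterval n α i j) :
    ((min (i - 1) (n - j) : ℕ) : ℝ≥0∞) ≤ fpdStalk k (intervalModule k n α i j) 1 := by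
  obtain ⟨s, hsS, hs⟩ := exists_strictMono_key (Finset.Ico 1 i) (leftKey α)
    (fun x hx y hy => leftKey_injective (Finset.mem_Ico.1 hx).1 (Finset.mem_Ico.1 hy).1)
    (r := min (i - 1) (n - j)) (by rw [Nat.card_Ico]; omega)
  obtain ⟨t, htS, ht⟩ := exists_strictMono_key (Finset.Ioc j n) (fun t => -rightKey n α t)
    (fun x hx y hy hxy => rightKey_injective (Finset.mem_Ioc.1 hx).2 (Finset.mem_Ioc.1 hy).2
      (neg_injective hxy)) (r := min (i - 1) (n - j)) (by rw [Nat.card_Ioc]; omega)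
  simp only [Finset.mem_Ico, Finset.mem_Ioc] at hsS htS
  have hC : ∀ a b, s a ≤ t b := fun a b => (hsS a).2.le.trans (hij.trans (htS b).1.le)
  have hst : ∀ a, 1 ≤ s a ∧ s a ≤ t a ∧ t a ≤ n := fun a => ⟨(hsS a).1, hC a a, (htS a).2⟩
  have hP := fun a => isProperInterval_intervalModule (k := k) (α := α) (hst a).1 (hst a).2.1
    (hst a).2.2
  refine le_fpdStalk _ 1 s t hst hC hs (fun a b hab => neg_lt_neg_iff.1 (ht hab)) fun a b => ?_
  have ha := hsS a
  have hb := hsS b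
  have ha' := htS a
  have hb' := htS b
  rw [stalkHomDim_shift_one, (hP a).extDim_tensor_eq (hP b) hi hj (by omega), if_pos]
  rw [max_eq_left hb.2.le, min_eq_left hb'.1.le]
  have h1 := leftKey_max_le h.1 ha.1
  have h2 := rightKey_min_le h.2 ha'.2
  rw [max_eq_left ha.2.le] at h1
  rw [min_eq_left ha'.1.le] at h2
  exact ⟨lt_of_le_of_ne h1 fun h' => ha.2.ne' (leftKey_injective hi ha.1 h'),
    lt_of_le_of_ne h2 fun h' => ha'.1.ne (rightKey_injective hj ha'.2 h')⟩

end FinRep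

theorem theorem0p8 (k : Type u) [Field k] [IsAlgClosed k] (n : ℕ) (α : ℕ → ArrowDir)
    [HasDerivedCategory.{w} (FinRep k (TypeAVertex n α))]
    (i j : ℕ) (hi : 1 ≤ i) (hij : i ≤ j) (hj : j ≤ n) :
    (∀ m : ℤ, m < 0 ∨ 1 < m → fpdStalk k (intervalModule k n α i j) m = 0) ∧
    ((IsSinkInterval n α i j → fpdStalk k (intervalModule k n α i j) 0 = 1) ∧
      (IsSourceInterval n α i j →
        fpdStalk k (intervalModule k n α i j) 0 = ((min i (n - j + 1) : ℕ) : ℝ≥0∞)) ∧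
      (IsFlowInterval n α i j → fpdStalk k (intervalModule k n α i j) 0 = 1)) ∧
    ((IsSinkInterval n α i j →
        fpdStalk k (intervalModule k n α i j) 1 = ((min (i - 1) (n - j) : ℕ) : ℝ≥0∞)) ∧
      (IsSourceInterval n α i j → fpdStalk k (intervalModule k n α i j) 1 = 0) ∧
      (IsFlowInterval n α i j → fpdStalk k (intervalModule k n α i j) 1 = 0)) := by
  refine ⟨fun m hm => FinRep.fpdStalk_eq_zero_of_shift _ hm,
    ⟨fun h => le_antisymm (FinRep.fpdStalk_zero_le_one_of_left hi hj h.1)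
        (FinRep.one_le_fpdStalk_zero hi hij hj),
      fun h => le_antisymm (FinRep.fpdStalk_zero_le_of_isSourceInterval hi hij hj h)
        (FinRep.le_fpdStalk_zero_of_isSourceInterval hi hij hj h),
      fun h => le_antisymm ?_ (FinRep.one_le_fpdStalk_zero hi hij hj)⟩,
    ⟨fun h => le_antisymm (FinRep.fpdStalk_one_le_of_isSinkInterval hi hij hj h)
        (FinRep.le_fpdStalk_one_of_isSinkInterval hi hij hj h),
      fun h => FinRep.fpdStalk_one_eq_zero_of_left hi hj h.1, fun h => ?_⟩⟩
  · cases hα : α (i - 1)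
    · exact FinRep.fpdStalk_zero_le_one_of_left hi hj (Or.inr hα)
    · exact FinRep.fpdStalk_zero_le_one_of_right hi hj (Or.inr (h.2.2 ▸ hα))
  · cases hα : α (i - 1)
    · exact FinRep.fpdStalk_one_eq_zero_of_right hi hj (Or.inr (h.2.2 ▸ hα))
    · exact FinRep.fpdStalk_one_eq_zero_of_left hi hj (Or.inr hα)
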